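/- **Setting.** Let $d\ge 1$, $0<\varepsilon\le 1/12$, and let $A=\mathrm{diag}(a_1,\dots,a_d)$ be a real diagonal matrix with $a_1\ge\cdots\ge a_d>0$, $2a_d\ge a_1$ and $\mathrm{Tr}\,A=d$. Let $G\sim\mathrm{GOE}(d)$, i.e. $G$ is a real symmetric $d\times d$ matrix whose entries on and above the diagonal are independent, $\mathcal N(0,2/d)$ on the diagonal and $\mathcal N(0,1/d)$ above it. Let $M=G-\frac{\mathrm{Tr}\,G}{d}I_d$, and let $\overline M$ have the law of $M$ conditioned on the event $U=\{\|M\|_{\mathrm{op}}\le 3,\ \|M\|_F^2\ge d/4\}$. Consider the two hypotheses $$H_0:\ \rho=\tfrac1d A,\qquad\qquad H_1:\ \rho=\tfrac1d\left(A+\varepsilon\overline M\right),$$ where under $H_1$ the matrix $\overline M$ is drawn once and all copies are in the same state. An algorithm that uses $n$ incoherent measurements is a tree $\mathcal T$ of depth $n$: each internal node, labelled by the outcomes $(x_1,\dots,x_t)$ observed so far, carries a POVM $\{E_z\}_z$ (a finite family of positive semidefinite complex $d\times d$ matrices with $\sum_z E_z=I_d$), which is applied to the next copy and gives outcome $z$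 with probability $\mathrm{Tr}(\rho E_z)$; at each leaf the algorithm outputs a (possibly randomized) guess in $\{H_0,H_1\}$. Let $p_0$ be the distribution of the leaf reached under $H_0$, and $p_1$ the one under $H_1$ (averaged over $\overline M$). **Theorem.** 1. There are absolute constants $c>0$ and $d_0$ such that, for all $d\ge d_0$ and all $\varepsilon$ and $A$ as above, every algorithm using $n$ incoherent measurements that guesses correctly with probability at least $2/3$ under $H_0$ and with probability at least $2/3$ under $H_1$ has $$n\ \ge\ c\,\frac{d^{3/2}}{\varepsilon^2}.$$ 2. The total variation distance between the leaf distributions is $o(1)$ whenever $n\ll d^{3/2}/\varepsilon^2$. That is, for every $\delta>0$ there are $c>0$ and $d_0$, depending only on $\delta$, such that for all $d\ge d_0$, all $\varepsilon$ and $A$ as above, all $n\le c\,d^{3/2}/\varepsilon^2$ and every tree $\mathcal T$ of depth $n$, $$d_{\mathrm{TV}}(p_0,p_1)=\tfrac12\sum_{x}|p_0(x)-p_1(x)|\ \le\ \delta.$$ -/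

import Mathlib

open MeasureTheory ProbabilityTheory
open scoped ComplexOrder

/-- A positive operator valued measurement on `ℂ^d` with outcomes in `Z`: a finite family of
positive semidefinite matrices summing to the identity. -/
structure POVM (d : ℕ) (Z : Type) [Fintype Z] where
  elem : Z → Matrix (Fin d) (Fin d) ℂ
  posSemidef : ∀ z, (elem z).PosSemidef
  sum_elem : ∑ z, elem z = 1

/-- The probability `Tr (ρ E_z)` of observing `z` when `ρ` is measured. -/
noncomputable def POVM.prob {d : ℕ} {Z : Type} [Fintype Z] (P : POVM d Z)
    (ρ : Matrix (Fin d) (Fin d) ℂ) (z : Z) : ℝ :=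
  (Matrix.trace (ρ * P.elem z)).re

/-- An adaptive strategy that makes `n` incoherent measurements, as a tree of depth `n`: the nodes
at depth `t` are the strings of `t` outcomes, and each internal node carries the POVM applied to the
next copy. POVM elements may vanish, so one finite set `Z` of outcome labels serves for all nodes;
rank-one POVMs `{ω_x d x x†}` are a special case. -/
structure LearningTree (d n : ℕ) (Z : Type) [Fintype Z] where
  povm : (t : Fin n) → (Fin t → Z) → POVM d Z

/-- The probability of reaching the leaf `x = (x_1, …, x_n)` when each copy is in the state `ρ`:
the product over the root-to-leaf path of the conditional outcome probabilities. -/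
noncomputable def LearningTree.leafProb {d n : ℕ} {Z : Type} [Fintype Z] (T : LearningTree d n Z)
    (ρ : Matrix (Fin d) (Fin d) ℂ) (x : Fin n → Z) : ℝ :=
  ∏ t : Fin n, (T.povm t fun j => x (Fin.castLE t.isLt.le j)).prob ρ (x t)

/-- Real matrices carry the product (Borel) sigma-algebra of their entries. -/
instance instMeasurableSpaceRealMatrix (m n : Type) : MeasurableSpace (Matrix m n ℝ) :=
  inferInstanceAs (MeasurableSpace (m → n → ℝ))

/-- The law of `GOE(d)`: real symmetric `d × d` matrices with independent entries on and above the
diagonal, `N(0, 2/d)` on it and `N(0, 1/d)` off it. The independent entries are indexed by the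
unordered pairs `{i, j}`. -/
noncomputable def goe (d : ℕ) : Measure (Matrix (Fin d) (Fin d) ℝ) :=
  (Measure.pi fun p : Sym2 (Fin d) =>
    gaussianReal 0 (if p.IsDiag then 2 / (d : NNReal) else 1 / (d : NNReal))).map
    fun g => Matrix.of fun i j => g s(i, j)

/-- The law of a trace-centered GOE matrix `M = G - (Tr G / d) I`, where `G ∼ GOE(d)`. -/
noncomputable def goeStar (d : ℕ) : Measure (Matrix (Fin d) (Fin d) ℝ) :=
  (goe d).map fun G => G - (G.trace / (d : ℝ)) • (1 : Matrix (Fin d) (Fin d) ℝ)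

/-- The truncation event `‖M‖_op ≤ 3` and `‖M‖_F² ≥ d / 4`. -/
def truncationSet (d : ℕ) : Set (Matrix (Fin d) (Fin d) ℝ) :=
  {M | ‖Matrix.toEuclideanCLM (n := Fin d) (𝕜 := ℝ) M‖ ≤ 3 ∧
    (d : ℝ) / 4 ≤ ∑ i, ∑ j, M i j ^ 2}

/-- The law of a truncated trace-centered GOE matrix: `goeStar d` conditioned on `truncationSet d`. -/
noncomputable def truncatedGoeStar (d : ℕ) : Measure (Matrix (Fin d) (Fin d) ℝ) :=
  ProbabilityTheory.cond (goeStar d) (truncationSet d)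

/-- The state `(A + ε M) / d`, where `A` is diagonal with entries `a`. -/
noncomputable def perturbedState {d : ℕ} (a : Fin d → ℝ) (ε : ℝ) (M : Matrix (Fin d) (Fin d) ℝ) :
    Matrix (Fin d) (Fin d) ℂ :=
  ((1 / (d : ℝ)) • (Matrix.diagonal a + ε • M)).map fun r : ℝ => (r : ℂ)

/-- The null hypothesis `ρ = A / d`. -/
noncomputable def nullState {d : ℕ} (a : Fin d → ℝ) : Matrix (Fin d) (Fin d) ℂ :=
  ((1 / (d : ℝ)) • Matrix.diagonal a).map fun r : ℝ => (r : ℂ)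

/-- The leaf distribution `p₀` under the null hypothesis. -/
noncomputable def LearningTree.nullDist {d n : ℕ} {Z : Type} [Fintype Z] (T : LearningTree d n Z)
    (a : Fin d → ℝ) (x : Fin n → Z) : ℝ :=
  T.leafProb (nullState a) x

/-- The leaf distribution `p₁` under the alternative hypothesis: all `n` copies are in the same
random state `(A + ε M) / d`, and `M` is a truncated trace-centered GOE matrix. -/
noncomputable def LearningTree.altDist {d n : ℕ} {Z : Type} [Fintype Z] (T : LearningTree d n Z)
    (a : Fin d → ℝ) (ε : ℝ) (x : Fin n → Z) : ℝ :=
  ∫ M, T.leafProb (perturbedState a ε M) x ∂(truncatedGoeStar d)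

/-- Total variation distance of two distributions on a finite set, given by their probabilities. -/
noncomputable def tvDist {S : Type} [Fintype S] (p q : S → ℝ) : ℝ :=
  (1 / 2) * ∑ x, |p x - q x|

/-- The algorithm that runs `T` and at the leaf `x` answers "alternative" with probability `φ x` and
"null" with probability `1 - φ x` succeeds with probability at least `2 / 3` under each of the two
hypotheses. -/
def LearningTree.Distinguishes {d n : ℕ} {Z : Type} [Fintype Z]
    (T : LearningTree d n Z) (a : Fin d → ℝ) (ε : ℝ) (φ : (Fin n → Z) → ℝ) : Prop :=
  (∀ x, 0 ≤ φ x ∧ φ x ≤ 1) ∧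
    2 / 3 ≤ ∑ x, T.nullDist a x * (1 - φ x) ∧
    2 / 3 ≤ ∑ x, T.altDist a ε x * φ x

/-- The reference matrix `A = diag(a_1, …, a_d)`: `a_1 ≥ ⋯ ≥ a_d > 0`, `2 a_d ≥ a_1` and
`Tr A = d`. -/
structure IsReference {d : ℕ} (a : Fin d → ℝ) : Prop where
  antitone : Antitone a
  pos : ∀ i, 0 < a i
  comparable : ∀ i j, a i ≤ 2 * a j
  trace_eq : ∑ i, a i = d

/-!
Let `y_t` be the (real part of the) POVM element observed at step `t` on the path to a leaf,
normalized so that `⟨A, y_t⟩ = 1`, and `c(y_t)` its traceless part. The likelihood ratio of the leaf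
is `L = 𝔼 ∏ (1 + ε ⟨M, y_t⟩)`, and `d_TV(p₀, p₁) = 𝔼₀ (1 - L)⁺`, so it suffices to bound `L` from
below. Translating the Gaussian by `(2 ε / d) S`, where `S = ∑ c(y_t)`, and applying Jensen's
inequality on a symmetric set of typical matrices, on which odd terms average to zero, bounds
`log L` from below by about `(ε² / d) (‖S‖² - ∑ ‖c(y_t)‖²)`, up to lower-order terms.

Under `p₀` the matrices `c(y_t)` are martingale increments whose conditional covariance is at most
`2 / d`: each `y_t` is positive semidefinite of trace at most `2`, so its Frobenius norm is bounded,
while its mean is `I / d`. Hence `‖S‖² - ∑ ‖c(y_t)‖²` is a martingale of size `O(n / √d)`, and the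
deficit `(1 - L)⁺` is `O(n ε² / d^{3/2})` in mean.
-/

section Gaussian

open scoped NNReal ENNReal

lemma gaussianReal_withDensity_exp (h : ℝ) {v : ℝ≥0} (hv : v ≠ 0) :
    (gaussianReal 0 v).withDensity
      (fun x => ENNReal.ofReal (Real.exp (-(h * x / v) - h ^ 2 / (2 * v)))) =
      gaussianReal (-h) v := by
  rw [gaussianReal_of_var_ne_zero _ hv, gaussianReal_of_var_ne_zero _ hv,
    ← withDensity_mul _ (measurable_gaussianPDF _ _) (by fun_prop)]
  congr 1
  ext x
  have hv' : (v : ℝ) ≠ 0 := by exact_mod_cast hv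
  simp only [Pi.mul_apply, gaussianPDF, gaussianPDFReal]
  rw [← ENNReal.ofReal_mul (by positivity), mul_assoc, ← Real.exp_add]
  congr 3
  field_simp
  ring

lemma integral_pow_four_gaussianReal (v : ℝ≥0) :
    ∫ x, x ^ 4 ∂gaussianReal 0 v = 3 * (v : ℝ) ^ 2 := by
  have hasDeriv (q : Polynomial ℝ) :
      deriv (fun t => q.eval t * Real.exp (v * t ^ 2 / 2)) =
        fun t => (q.derivative + .C (v : ℝ) * .X * q).eval t * Real.exp (v * t ^ 2 / 2) := by
    ext t
    have hexp : HasDerivAt (fun t : ℝ => Real.exp (v * t ^ 2 / 2))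
        (Real.exp (v * t ^ 2 / 2) * (v * (2 * t) / 2)) t := by
      simpa using ((((hasDerivAt_pow 2 t).const_mul (v : ℝ)).div_const 2).exp)
    rw [((q.hasDerivAt t).fun_mul hexp).deriv]
    simp only [Polynomial.eval_add, Polynomial.eval_mul, Polynomial.eval_C, Polynomial.eval_X]
    ring
  have hmgf : mgf id (gaussianReal 0 v) =
      fun t => (1 : Polynomial ℝ).eval t * Real.exp (v * t ^ 2 / 2) := by
    simp [mgf_id_gaussianReal]
  have hmoment := iteratedDeriv_mgf_zero (X := id) (μ := gaussianReal 0 v)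
    (by simp [integrableExpSet_id_gaussianReal]) 4
  simp only [hmgf, iteratedDeriv_succ, iteratedDeriv_zero, hasDeriv] at hmoment
  simp only [Pi.pow_apply, id_eq] at hmoment
  rw [← hmoment]
  simp
  ring

section Product

variable {ι : Type*} [Fintype ι]

lemma pi_withDensity {α : ι → Type*} [∀ i, MeasurableSpace (α i)] (μ : ∀ i, Measure (α i))
    [∀ i, IsProbabilityMeasure (μ i)] {f : ∀ i, α i → ℝ≥0∞} (hf : ∀ i, Measurable (f i))
    [∀ i, SigmaFinite ((μ i).withDensity (f i))] :
    (Measure.pi μ).withDensity (fun g => ∏ i, f i (g i)) =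
      Measure.pi fun i => (μ i).withDensity (f i) := by
  refine (Measure.pi_eq fun s hs => ?_).symm
  have hprod : (Set.univ.pi s).indicator (fun g => ∏ i, f i (g i)) =
      fun g => ∏ i, (s i).indicator (f i) (g i) := by
    classical
    ext g
    simp [Set.indicator_apply, Finset.prod_ite_zero]
  have hmeas (i : ι) : Measurable ((s i).indicator (f i)) := (hf i).indicator (hs i)
  rw [withDensity_apply _ (.univ_pi hs), ← lintegral_indicator (.univ_pi hs), hprod,
    lintegral_prod_eq_prod_lintegral_of_indepFun Finset.univ
      (fun i (g : ∀ i, α i) => (s i).indicator (f i) (g i))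
      (iIndepFun_pi (X := fun i => (s i).indicator (f i)) fun i => (hmeas i).aemeasurable)
      fun i => (hmeas i).comp (measurable_pi_apply i)]
  refine Finset.prod_congr rfl fun i _ => ?_
  rw [withDensity_apply _ (hs i), ← lintegral_indicator (hs i)]
  exact (measurePreserving_eval μ i).lintegral_comp (hmeas i)

/-- The law of a vector of independent centered Gaussian variables with variances `v`. -/
noncomputable abbrev gaussianPi (v : ι → ℝ≥0) : Measure (ι → ℝ) :=
  Measure.pi fun i => gaussianReal 0 (v i)

lemma map_add_pi_gaussianReal (v : ι → ℝ≥0) (h : ι → ℝ) :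
    (Measure.pi fun i => gaussianReal (-h i) (v i)).map (fun g => g + h) = gaussianPi v := by
  have hmap (i : ι) : (gaussianReal (-h i) (v i)).map (· + h i) = gaussianReal 0 (v i) := by
    rw [gaussianReal_map_add_const, neg_add_cancel]
  have hpi := Measure.pi_map_pi (μ := fun i => gaussianReal (-h i) (v i))
    (f := fun i x => x + h i) (hμ := fun i => by rw [hmap]; infer_instance) fun i => by fun_prop
  simp only [hmap] at hpi
  exact hpi

lemma lintegral_gaussianPi_shift {v : ι → ℝ≥0} (hv : ∀ i, v i ≠ 0) (h : ι → ℝ)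
    {f : (ι → ℝ) → ℝ≥0∞} (hf : Measurable f) :
    ∫⁻ g, f g ∂gaussianPi v =
      ∫⁻ g, ENNReal.ofReal (Real.exp (∑ i, (-(h i * g i / v i) - h i ^ 2 / (2 * v i)))) * f (g + h)
        ∂gaussianPi v := by
  have htilt (i : ι) := gaussianReal_withDensity_exp (h i) (hv i)
  have hσ (i : ι) : SigmaFinite ((gaussianReal 0 (v i)).withDensity fun x =>
      ENNReal.ofReal (Real.exp (-(h i * x / v i) - h i ^ 2 / (2 * v i)))) := by
    rw [htilt]; infer_instance
  have hpi := pi_withDensity (fun i => gaussianReal 0 (v i))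
    (f := fun i x => ENNReal.ofReal (Real.exp (-(h i * x / v i) - h i ^ 2 / (2 * v i))))
    fun i => by fun_prop
  simp_rw [htilt] at hpi
  conv_lhs => rw [← map_add_pi_gaussianReal v h]
  rw [lintegral_map hf (by fun_prop), ← hpi,
    lintegral_withDensity_eq_lintegral_mul _ (by fun_prop)
      (show Measurable fun g => f (g + h) from hf.comp (by fun_prop))]
  refine lintegral_congr fun g => ?_
  rw [Pi.mul_apply, ← ENNReal.ofReal_prod_of_nonneg fun i _ => (Real.exp_pos _).le, ← Real.exp_sum]

lemma measurePreserving_neg_gaussianPi (v : ι → ℝ≥0) :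
    MeasurePreserving (fun g => -g) (gaussianPi v) (gaussianPi v) :=
  measurePreserving_pi _ _ fun i => ⟨measurable_neg, by
    have hneg := gaussianReal_map_neg (μ := 0) (v := v i)
    rwa [neg_zero] at hneg⟩

variable (v : ι → ℝ≥0) (c : ι → ℝ)

lemma memLp_eval_gaussianPi (i : ι) {p : ℝ≥0∞} (hp : p ≠ ⊤) :
    MemLp (fun g : ι → ℝ => g i) p (gaussianPi v) :=
  (memLp_id_gaussianReal' (μ := 0) (v := v i) p hp).comp_measurePreserving
    (measurePreserving_eval _ i)

lemma memLp_linear_gaussianPi {p : ℝ≥0∞} (hp : p ≠ ⊤) :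
    MemLp (fun g : ι → ℝ => ∑ i, c i * g i) p (gaussianPi v) :=
  memLp_finsetSum _ fun i _ => (memLp_eval_gaussianPi v i hp).const_mul (c i)

lemma integral_linear_gaussianPi : ∫ g, ∑ i, c i * g i ∂gaussianPi v = 0 := by
  rw [integral_finsetSum _ fun i _ =>
    ((memLp_eval_gaussianPi v i (by simp)).integrable le_rfl).const_mul _]
  refine Finset.sum_eq_zero fun i _ => ?_
  rw [integral_const_mul, integral_comp_eval (μ := fun i => gaussianReal 0 (v i))
    (f := fun x : ℝ => x) (by fun_prop),
    integral_id_gaussianReal, mul_zero]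

lemma hasLaw_linear_gaussianPi :
    HasLaw (fun g : ι → ℝ => ∑ i, c i * g i)
      (gaussianReal 0 (∑ i, c i ^ 2 * v i : ℝ).toNNReal) (gaussianPi v) := by
  have hvar : Var[fun g : ι → ℝ => ∑ i, c i * g i; gaussianPi v] = ∑ i, c i ^ 2 * v i := by
    rw [← Finset.sum_fn, variance_sum_pi (X := fun i x => c i * x) fun i =>
      (memLp_id_gaussianReal' 2 (by simp)).const_mul (c i)]
    exact Finset.sum_congr rfl fun i _ => by
      rw [variance_const_mul, variance_fun_id_gaussianReal]
  have hgauss : HasGaussianLaw (fun g : ι → ℝ => ∑ i, c i * g i) (gaussianPi v) := by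
    refine iIndepFun.hasGaussianLaw_fun_sum (fun i => ?_) (iIndepFun_pi fun i => by fun_prop)
    have hi : HasLaw (fun g : ι → ℝ => g i) (gaussianReal 0 (v i)) (gaussianPi v) :=
      (measurePreserving_eval (fun i => gaussianReal 0 (v i)) i).hasLaw
    exact ⟨by rw [(gaussianReal_const_mul hi (c i)).map_eq]; infer_instance⟩
  exact ⟨(memLp_linear_gaussianPi v c ENNReal.one_ne_top).aemeasurable, by
    rw [hgauss.map_eq_gaussianReal, hvar, integral_linear_gaussianPi]⟩

lemma integral_linear_sq_gaussianPi :
    ∫ g, (∑ i, c i * g i) ^ 2 ∂gaussianPi v = ∑ i, c i ^ 2 * v i := by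
  rw [← variance_of_integral_eq_zero
      (memLp_linear_gaussianPi v c ENNReal.one_ne_top).aemeasurable
      (integral_linear_gaussianPi v c),
    (hasLaw_linear_gaussianPi v c).variance_eq, variance_id_gaussianReal,
    Real.coe_toNNReal _ (by positivity)]

lemma integral_linear_pow_four_gaussianPi :
    ∫ g, (∑ i, c i * g i) ^ 4 ∂gaussianPi v = 3 * (∑ i, c i ^ 2 * v i) ^ 2 := by
  have h := (hasLaw_linear_gaussianPi v c).integral_comp (f := fun x => x ^ 4) (by fun_prop)
  rw [integral_pow_four_gaussianReal, Real.coe_toNNReal _ (by positivity)] at h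
  exact h

end Product

lemma ofReal_exp_integral_le_lintegral {Ω : Type*} [MeasurableSpace Ω] {μ : Measure Ω}
    [IsProbabilityMeasure μ] {φ : Ω → ℝ} (hφ : Integrable φ μ) :
    ENNReal.ofReal (Real.exp (∫ x, φ x ∂μ)) ≤ ∫⁻ x, ENNReal.ofReal (Real.exp (φ x)) ∂μ := by
  by_cases hexp : Integrable (fun x => Real.exp (φ x)) μ
  · rw [← ofReal_integral_eq_lintegral_ofReal hexp (.of_forall fun x => (Real.exp_pos _).le)]
    exact ENNReal.ofReal_le_ofReal <| convexOn_exp.map_integral_le Real.continuous_exp.continuousOn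
      isClosed_univ (.of_forall fun x => Set.mem_univ _) hφ hexp
  · have : ∫⁻ x, ENNReal.ofReal (Real.exp (φ x)) ∂μ = ⊤ := by
      by_contra h
      exact hexp ((lintegral_ofReal_ne_top_iff_integrable
        (Real.continuous_exp.comp_aestronglyMeasurable hφ.1)
        (.of_forall fun x => (Real.exp_pos _).le)).1 h)
    exact this ▸ le_top

end Gaussian

section Frobenius

open Matrix
open scoped Matrix.Norms.Frobenius InnerProductSpace

variable {m n : Type*} [Fintype m] [Fintype n]

/-- The Frobenius inner product `∑ i j, X i j * Y i j` of real matrices, which induces the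
Frobenius norm. -/
noncomputable instance frobeniusInnerProductSpace : InnerProductSpace ℝ (Matrix m n ℝ) where
  inner X Y := ∑ i, ∑ j, X i j * Y i j
  norm_sq_eq_re_inner X := by
    rw [frobenius_norm_def, ← Real.sqrt_eq_rpow, Real.sq_sqrt (by positivity)]
    simp [sq]
  conj_inner_symm X Y := by simp [mul_comm]
  add_left X Y W := by simp [add_mul, Finset.sum_add_distrib]
  smul_left X Y r := by simp [Finset.mul_sum, mul_assoc]

lemma frobenius_inner_eq_sum (X Y : Matrix m n ℝ) : ⟪X, Y⟫_ℝ = ∑ i, ∑ j, X i j * Y i j := rfl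

lemma frobenius_norm_sq_eq_sum (X : Matrix m n ℝ) : ‖X‖ ^ 2 = ∑ i, ∑ j, X i j ^ 2 := by
  rw [← real_inner_self_eq_norm_sq, frobenius_inner_eq_sum]
  simp only [sq]

lemma frobenius_inner_eq_trace (X Y : Matrix m n ℝ) : ⟪X, Y⟫_ℝ = (X * Yᵀ).trace := by
  simp [frobenius_inner_eq_sum, trace, mul_apply]

lemma dotProduct_mulVec_eq_inner (M : Matrix m m ℝ) (x : m → ℝ) :
    x ⬝ᵥ M *ᵥ x = ⟪M, vecMulVec x x⟫_ℝ := by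
  simp only [frobenius_inner_eq_trace, transpose_vecMulVec, mul_vecMulVec, trace_vecMulVec,
    dotProduct_comm]

lemma frobenius_norm_vecMulVec (x : m → ℝ) : ‖vecMulVec x x‖ = x ⬝ᵥ x := by
  refine (sq_eq_sq₀ (norm_nonneg _) (dotProduct_star_self_nonneg x)).1 ?_
  rw [← real_inner_self_eq_norm_sq, ← dotProduct_mulVec_eq_inner, vecMulVec_mulVec]
  simp [sq]

lemma abs_dotProduct_mulVec_le_frobenius_norm (M : Matrix m m ℝ) (x : m → ℝ) :
    |x ⬝ᵥ M *ᵥ x| ≤ ‖M‖ * (x ⬝ᵥ x) := by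
  rw [dotProduct_mulVec_eq_inner, ← frobenius_norm_vecMulVec]
  exact abs_real_inner_le_norm _ _

section Center

variable [DecidableEq m]

lemma frobenius_inner_one_right (X : Matrix m m ℝ) : ⟪X, 1⟫_ℝ = X.trace := by
  rw [frobenius_inner_eq_trace, transpose_one, mul_one]

/-- The orthogonal projection `X ↦ X - (Tr X / d) I` onto the matrices of trace zero. -/
noncomputable def center : Matrix m m ℝ →ₗ[ℝ] Matrix m m ℝ :=
  LinearMap.id - (traceLinearMap m ℝ ℝ).smulRight ((Fintype.card m : ℝ)⁻¹ • 1)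

lemma center_apply (X : Matrix m m ℝ) : center X = X - (X.trace / Fintype.card m) • 1 := by
  simp [center, smul_smul, div_eq_mul_inv]

lemma center_isSymm {X : Matrix m m ℝ} (hX : X.IsSymm) : (center X).IsSymm := by
  rw [center_apply]
  exact hX.sub (isSymm_one.smul _)

lemma inner_center_left (X Y : Matrix m m ℝ) : ⟪center X, Y⟫_ℝ = ⟪X, center Y⟫_ℝ := by
  simp only [center_apply, inner_sub_left, inner_sub_right, real_inner_smul_left,
    real_inner_smul_right, frobenius_inner_one_right, real_inner_comm Y 1]
  ring

lemma center_of_trace_eq_zero {X : Matrix m m ℝ} (hX : X.trace = 0) : center X = X := by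
  simp [center_apply, hX]

lemma trace_center (X : Matrix m m ℝ) : (center X).trace = 0 := by
  cases isEmpty_or_nonempty m <;> simp [center_apply, trace, mul_div_cancel₀]

lemma center_center (X : Matrix m m ℝ) : center (center X) = center X :=
  center_of_trace_eq_zero (trace_center X)

lemma norm_center_le (X : Matrix m m ℝ) : ‖center X‖ ≤ ‖X‖ := by
  have hsq : ‖center X‖ * ‖center X‖ ≤ ‖X‖ * ‖center X‖ := by
    rw [← real_inner_self_eq_norm_mul_norm, inner_center_left, center_center]
    exact real_inner_le_norm _ _
  by_contra! h
  exact absurd hsq (not_le.2 (mul_lt_mul_of_pos_right h ((norm_nonneg _).trans_lt h)))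

end Center

section OperatorNorm

variable [DecidableEq m]

lemma inner_toEuclideanCLM_self (M : Matrix m m ℝ) (x : EuclideanSpace ℝ m) :
    ⟪toEuclideanCLM (n := m) (𝕜 := ℝ) M x, x⟫_ℝ = x.ofLp ⬝ᵥ M *ᵥ x.ofLp := by
  rw [EuclideanSpace.inner_eq_star_dotProduct, ofLp_toEuclideanCLM, star_trivial]

lemma abs_rayleighQuotient_toEuclideanCLM_mul (M : Matrix m m ℝ) (x : EuclideanSpace ℝ m) :
    |(toEuclideanCLM (n := m) (𝕜 := ℝ) M).rayleighQuotient x| * (x.ofLp ⬝ᵥ x.ofLp) =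
      |x.ofLp ⬝ᵥ M *ᵥ x.ofLp| := by
  have hnorm : x.ofLp ⬝ᵥ x.ofLp = ‖x‖ ^ 2 := by
    rw [EuclideanSpace.real_norm_sq_eq]; simp only [dotProduct, sq]
  rw [hnorm, ← inner_toEuclideanCLM_self]
  rcases eq_or_ne x 0 with rfl | hx
  · simp
  · rw [ContinuousLinearMap.rayleighQuotient, ContinuousLinearMap.reApplyInnerSelf, abs_div,
      abs_of_nonneg (sq_nonneg ‖x‖), div_mul_cancel₀ _ (by positivity), RCLike.re_to_real]

lemma norm_toEuclideanCLM_le_iff {M : Matrix m m ℝ} (hM : M.IsSymm) {t : ℝ} (ht : 0 ≤ t) :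
    ‖toEuclideanCLM (n := m) (𝕜 := ℝ) M‖ ≤ t ↔ ∀ x : m → ℝ, |x ⬝ᵥ M *ᵥ x| ≤ t * (x ⬝ᵥ x) := by
  set T := toEuclideanCLM (n := m) (𝕜 := ℝ) M with hT
  have hsymm : T.IsSymmetric := by
    rw [hT, coe_toEuclideanCLM_eq_toEuclideanLin, isSymmetric_toEuclideanLin_iff, IsHermitian,
      conjTranspose_eq_transpose_of_trivial, hM]
  refine ⟨fun h x => ?_, fun h => ?_⟩
  · rw [← abs_rayleighQuotient_toEuclideanCLM_mul M (WithLp.toLp 2 x)]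
    exact mul_le_mul_of_nonneg_right ((T.rayleighQuotient_le_norm _).trans h)
      (dotProduct_star_self_nonneg x)
  · rw [T.norm_eq_iSup_rayleighQuotient hsymm]
    refine ciSup_le fun x => ?_
    rcases eq_or_ne x 0 with rfl | hx
    · simpa using ht
    · have hpos : 0 < x.ofLp ⬝ᵥ x.ofLp :=
        (dotProduct_star_self_nonneg x.ofLp).lt_of_ne' (by simpa using hx)
      rw [← mul_le_mul_iff_of_pos_right hpos, abs_rayleighQuotient_toEuclideanCLM_mul]
      exact h _

end OperatorNorm

end Frobenius

section Goe

open scoped Matrix.Norms.Frobenius InnerProductSpace NNReal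

section SymmetricMatrices

variable {m : Type*}

/-- The symmetric matrix with entries `g` at the unordered pairs of indices. -/
def symMat : (Sym2 m → ℝ) →ₗ[ℝ] Matrix m m ℝ where
  toFun g := Matrix.of fun i j => g s(i, j)
  map_add' _ _ := rfl
  map_smul' _ _ := rfl

lemma symMat_apply (g : Sym2 m → ℝ) (i j : m) : symMat g i j = g s(i, j) := rfl

lemma symMat_isSymm (g : Sym2 m → ℝ) : (symMat g).IsSymm :=
  .ext fun i j => by rw [symMat_apply, symMat_apply, Sym2.eq_swap]

/-- The entries of the symmetric part of `X` at the unordered pairs of indices; a right inverse of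
`symMat` on symmetric matrices. -/
noncomputable def symEntries (X : Matrix m m ℝ) : Sym2 m → ℝ :=
  Sym2.lift ⟨fun i j => (X i j + X j i) / 2, fun i j => by simp only [add_comm]⟩

lemma symEntries_mk {X : Matrix m m ℝ} (hX : X.IsSymm) (i j : m) :
    symEntries X s(i, j) = X i j := by
  change (X i j + X j i) / 2 = X i j
  rw [hX.apply i j, add_self_div_two]

lemma symMat_symEntries {X : Matrix m m ℝ} (hX : X.IsSymm) : symMat (symEntries X) = X := by
  ext i j; rw [symMat_apply, symEntries_mk hX]

variable [DecidableEq m]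

/-- The number of matrix positions that carry an unordered pair of indices. -/
def pairMultiplicity (p : Sym2 m) : ℝ := if p.IsDiag then 1 else 2

lemma pairMultiplicity_pos (p : Sym2 m) : 0 < pairMultiplicity p := by
  unfold pairMultiplicity; split_ifs <;> norm_num

variable [Fintype m]

lemma card_filter_mk_eq (p : Sym2 m) :
    ((Finset.univ.filter fun q : m × m => s(q.1, q.2) = p).card : ℝ) = pairMultiplicity p := by
  induction p with
  | _ a b =>
    have hfiber : (Finset.univ.filter fun q : m × m => s(q.1, q.2) = s(a, b)) =
        {(a, b), (b, a)} := by
      ext ⟨x, y⟩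
      simp
    rw [hfiber]
    rcases eq_or_ne a b with rfl | hab
    · simp [pairMultiplicity]
    · rw [Finset.card_pair (by simp [hab])]
      simp [pairMultiplicity, hab]

lemma sum_sum_sym2 (F : Sym2 m → ℝ) :
    ∑ i, ∑ j, F s(i, j) = ∑ p, pairMultiplicity p * F p := by
  rw [← Fintype.sum_prod_type' (f := fun i j => F s(i, j)),
    ← Finset.sum_fiberwise (s := Finset.univ) (g := fun q : m × m => s(q.1, q.2))]
  refine Finset.sum_congr rfl fun p _ => ?_
  rw [← card_filter_mk_eq, ← nsmul_eq_mul, ← Finset.sum_const]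
  exact Finset.sum_congr rfl fun q hq => by rw [(Finset.mem_filter.1 hq).2]

lemma inner_eq_sum_symEntries {X Y : Matrix m m ℝ} (hX : X.IsSymm) (hY : Y.IsSymm) :
    ⟪X, Y⟫_ℝ = ∑ p, pairMultiplicity p * (symEntries X p * symEntries Y p) := by
  rw [← sum_sum_sym2]
  simp only [symEntries_mk hX, symEntries_mk hY, frobenius_inner_eq_sum]

lemma inner_symMat {X : Matrix m m ℝ} (hX : X.IsSymm) (g : Sym2 m → ℝ) :
    ⟪symMat g, X⟫_ℝ = ∑ p, pairMultiplicity p * symEntries X p * g p := by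
  simp only [mul_assoc]
  rw [← sum_sum_sym2 fun p => symEntries X p * g p]
  simp only [symEntries_mk hX, frobenius_inner_eq_sum, symMat_apply, mul_comm]

/-- The trace-centered symmetric matrix `M` with entries `g` before centering. -/
noncomputable def goeMat : (Sym2 m → ℝ) →ₗ[ℝ] Matrix m m ℝ := center ∘ₗ symMat

lemma goeMat_apply (g : Sym2 m → ℝ) : goeMat g = center (symMat g) := rfl

lemma goeMat_isSymm (g : Sym2 m → ℝ) : (goeMat g).IsSymm := center_isSymm (symMat_isSymm g)

lemma trace_goeMat (g : Sym2 m → ℝ) : (goeMat g).trace = 0 := trace_center _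

lemma goeMat_add_symEntries {H : Matrix m m ℝ} (hH : H.IsSymm) (htr : H.trace = 0)
    (g : Sym2 m → ℝ) : goeMat (g + symEntries H) = goeMat g + H := by
  rw [map_add, goeMat_apply (symEntries H), symMat_symEntries hH, center_of_trace_eq_zero htr]

/-- The coefficients of the linear functional `g ↦ ⟪goeMat g, X⟫`, for symmetric `X`. -/
noncomputable def goeCoeff (X : Matrix m m ℝ) (p : Sym2 m) : ℝ :=
  pairMultiplicity p * symEntries (center X) p

lemma inner_goeMat {X : Matrix m m ℝ} (hX : X.IsSymm) (g : Sym2 m → ℝ) :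
    ⟪goeMat g, X⟫_ℝ = ∑ p, goeCoeff X p * g p := by
  rw [goeMat_apply, inner_center_left, inner_symMat (center_isSymm hX)]
  rfl

end SymmetricMatrices

variable {d : ℕ}

/-- The variances of the independent entries of a `GOE(d)` matrix. -/
noncomputable def goeVar (d : ℕ) (p : Sym2 (Fin d)) : ℝ≥0 :=
  if p.IsDiag then 2 / (d : ℝ≥0) else 1 / (d : ℝ≥0)

lemma goeVar_eq (p : Sym2 (Fin d)) : (goeVar d p : ℝ) = 2 / d / pairMultiplicity p := by
  unfold goeVar pairMultiplicity
  split_ifs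
  · simp
  · simp only [NNReal.coe_div, NNReal.coe_one, NNReal.coe_natCast]; ring

lemma goeVar_ne_zero (hd : 0 < d) (p : Sym2 (Fin d)) : goeVar d p ≠ 0 := by
  unfold goeVar; split_ifs <;> simp [hd.ne']

/-- The law of the independent entries of a `GOE(d)` matrix. -/
noncomputable abbrev goeEntries (d : ℕ) : Measure (Sym2 (Fin d) → ℝ) := gaussianPi (goeVar d)

lemma sum_goeCoeff_sq {X : Matrix (Fin d) (Fin d) ℝ} (hX : X.IsSymm) :
    ∑ p, goeCoeff X p ^ 2 * (goeVar d p : ℝ) = 2 / d * ‖center X‖ ^ 2 := by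
  rw [← real_inner_self_eq_norm_sq,
    inner_eq_sum_symEntries (center_isSymm hX) (center_isSymm hX), Finset.mul_sum]
  refine Finset.sum_congr rfl fun p _ => ?_
  have := (pairMultiplicity_pos p).ne'
  rw [goeCoeff, goeVar_eq]
  field_simp

lemma memLp_inner_goeMat {X : Matrix (Fin d) (Fin d) ℝ} (hX : X.IsSymm) {p : ENNReal}
    (hp : p ≠ ⊤) : MemLp (fun g => ⟪goeMat g, X⟫_ℝ) p (goeEntries d) := by
  simp only [inner_goeMat hX]
  exact memLp_linear_gaussianPi _ _ hp

lemma integral_inner_goeMat_sq {X : Matrix (Fin d) (Fin d) ℝ} (hX : X.IsSymm) :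
    ∫ g, ⟪goeMat g, X⟫_ℝ ^ 2 ∂goeEntries d = 2 / d * ‖center X‖ ^ 2 := by
  simp only [inner_goeMat hX, integral_linear_sq_gaussianPi, sum_goeCoeff_sq hX]

lemma integral_inner_goeMat_pow_four {X : Matrix (Fin d) (Fin d) ℝ} (hX : X.IsSymm) :
    ∫ g, ⟪goeMat g, X⟫_ℝ ^ 4 ∂goeEntries d = 3 * (2 / d * ‖center X‖ ^ 2) ^ 2 := by
  simp only [inner_goeMat hX, integral_linear_pow_four_gaussianPi, sum_goeCoeff_sq hX]

lemma sum_shift_exponent (hd : 0 < d) {H : Matrix (Fin d) (Fin d) ℝ} (hH : H.IsSymm)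
    (htr : H.trace = 0) (g : Sym2 (Fin d) → ℝ) :
    ∑ p, (-(symEntries H p * g p / goeVar d p) - symEntries H p ^ 2 / (2 * goeVar d p)) =
      -(d / 2 * ⟪goeMat g, H⟫_ℝ) - d / 4 * ‖H‖ ^ 2 := by
  rw [goeMat_apply, inner_center_left, center_of_trace_eq_zero htr, inner_symMat hH,
    ← real_inner_self_eq_norm_sq, inner_eq_sum_symEntries hH hH, Finset.mul_sum, Finset.mul_sum,
    ← Finset.sum_neg_distrib, ← Finset.sum_sub_distrib]
  refine Finset.sum_congr rfl fun p _ => ?_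
  have := (pairMultiplicity_pos p).ne'
  rw [goeVar_eq]
  field_simp
  ring

lemma lintegral_goeEntries_shift (hd : 0 < d) {H : Matrix (Fin d) (Fin d) ℝ} (hH : H.IsSymm)
    (htr : H.trace = 0) {f : (Sym2 (Fin d) → ℝ) → ENNReal} (hf : Measurable f) :
    ∫⁻ g, f g ∂goeEntries d = ∫⁻ g, ENNReal.ofReal
      (Real.exp (-(d / 2 * ⟪goeMat g, H⟫_ℝ) - d / 4 * ‖H‖ ^ 2)) * f (g + symEntries H)
        ∂goeEntries d := by
  simpa only [sum_shift_exponent hd hH htr] using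
    lintegral_gaussianPi_shift (goeVar_ne_zero hd) (symEntries H) hf

end Goe

section PosSemidef

open Matrix
open scoped Matrix.Norms.Frobenius InnerProductSpace

variable {m : Type*}

lemma isSymm_of_posSemidef {B : Matrix m m ℝ} (hB : B.PosSemidef) : B.IsSymm := by
  rw [IsSymm, ← conjTranspose_eq_transpose_of_trivial]
  exact hB.isHermitian

/-- The entrywise real part of a complex matrix. -/
def rePart (E : Matrix m m ℂ) : Matrix m m ℝ := E.map Complex.re

lemma rePart_posSemidef [Finite m] {E : Matrix m m ℂ} (hE : E.PosSemidef) :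
    (rePart E).PosSemidef := by
  have := Fintype.ofFinite m
  refine .of_dotProduct_mulVec_nonneg ?_ fun x => ?_
  · ext i j
    simp [rePart, ← hE.isHermitian.apply i j]
  · have hquad := (Complex.le_def.1 (hE.dotProduct_mulVec_nonneg fun i => (x i : ℂ))).1
    simpa [dotProduct, mulVec, rePart] using hquad

variable [Fintype m]

lemma exists_eq_transpose_mul_self {B : Matrix m m ℝ} (hB : B.PosSemidef) :
    ∃ C : Matrix m m ℝ, B = Cᵀ * C := by
  classical
  open scoped MatrixOrder in
  obtain ⟨C, hC⟩ := CStarAlgebra.nonneg_iff_eq_star_mul_self.1 hB.nonneg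
  exact ⟨C, by rw [hC, star_eq_conjTranspose, conjTranspose_eq_transpose_of_trivial]⟩

lemma trace_transpose_mul_self_eq (C : Matrix m m ℝ) : (Cᵀ * C).trace = ‖C‖ ^ 2 := by
  rw [← real_inner_self_eq_norm_sq, frobenius_inner_eq_trace, trace_mul_comm]

lemma inner_transpose_mul_self (M C : Matrix m m ℝ) :
    ⟪M, Cᵀ * C⟫_ℝ = ∑ k, C k ⬝ᵥ M *ᵥ C k := by
  have hsum : Cᵀ * C = ∑ k, vecMulVec (C k) (C k) := by
    ext i j
    simp [mul_apply, Matrix.sum_apply, vecMulVec_apply]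
  simp only [hsum, inner_sum, dotProduct_mulVec_eq_inner]

lemma abs_inner_le_mul_trace {B M : Matrix m m ℝ} (hB : B.PosSemidef) {t : ℝ}
    (hM : ∀ x : m → ℝ, |x ⬝ᵥ M *ᵥ x| ≤ t * (x ⬝ᵥ x)) : |⟪M, B⟫_ℝ| ≤ t * B.trace := by
  classical
  obtain ⟨C, rfl⟩ := exists_eq_transpose_mul_self hB
  have htrace : (Cᵀ * C).trace = ∑ k, C k ⬝ᵥ C k := by
    rw [← frobenius_inner_one_right, real_inner_comm, inner_transpose_mul_self]
    simp only [one_mulVec]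
  rw [inner_transpose_mul_self, htrace, Finset.mul_sum]
  exact (Finset.abs_sum_le_sum_abs _ _).trans (Finset.sum_le_sum fun k _ => hM _)

lemma inner_sq_le_inner_mul_trace {B : Matrix m m ℝ} (hB : B.PosSemidef) (V : Matrix m m ℝ) :
    ⟪V, B⟫_ℝ ^ 2 ≤ ⟪Vᵀ * V, B⟫_ℝ * B.trace := by
  obtain ⟨C, rfl⟩ := exists_eq_transpose_mul_self hB
  have hinner : ⟪V, Cᵀ * C⟫_ℝ = ⟪C * Vᵀ, C⟫_ℝ := by
    rw [frobenius_inner_eq_trace, frobenius_inner_eq_trace, ← trace_transpose (C * Vᵀ * Cᵀ)]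
    simp only [transpose_mul, transpose_transpose]
    rw [← Matrix.mul_assoc, trace_mul_comm]
  have hnorm : ⟪Vᵀ * V, Cᵀ * C⟫_ℝ = ‖C * Vᵀ‖ ^ 2 := by
    rw [← real_inner_self_eq_norm_sq, frobenius_inner_eq_trace, frobenius_inner_eq_trace]
    simp only [transpose_mul, transpose_transpose]
    rw [← Matrix.mul_assoc, trace_mul_comm]
    simp only [Matrix.mul_assoc]
  rw [hinner, hnorm, trace_transpose_mul_self_eq, ← mul_pow, ← sq_abs]
  exact pow_le_pow_left₀ (abs_nonneg _) (abs_real_inner_le_norm _ _) 2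

lemma frobenius_norm_le_trace {B : Matrix m m ℝ} (hB : B.PosSemidef) : ‖B‖ ≤ B.trace := by
  obtain ⟨C, rfl⟩ := exists_eq_transpose_mul_self hB
  rw [trace_transpose_mul_self_eq, sq]
  exact (frobenius_norm_mul Cᵀ C).trans_eq (by rw [frobenius_norm_transpose])

lemma re_trace_map_ofReal_mul {E : Matrix m m ℂ} (hE : E.PosSemidef) (R : Matrix m m ℝ) :
    (Matrix.trace (R.map (fun r : ℝ => (r : ℂ)) * E)).re = ⟪R, rePart E⟫_ℝ := by
  rw [frobenius_inner_eq_trace, (isSymm_of_posSemidef (rePart_posSemidef hE)).eq]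
  simp [Matrix.trace, mul_apply, rePart]

end PosSemidef

section GaussianVector

open Matrix
open scoped NNReal ENNReal

lemma integral_sq_gaussianReal (v : ℝ≥0) : ∫ x, x ^ 2 ∂gaussianReal 0 v = v := by
  rw [← variance_of_integral_eq_zero (by fun_prop) integral_id_gaussianReal,
    variance_fun_id_gaussianReal]

lemma integrable_pow_gaussianReal (v : ℝ≥0) (k : ℕ) :
    Integrable (fun x : ℝ => x ^ k) (gaussianReal 0 v) := by
  have hnorm := (memLp_id_gaussianReal' (μ := 0) (v := v) k (by simp)).integrable_norm_pow'
  refine (integrable_norm_iff (by fun_prop)).1 ?_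
  simpa only [norm_pow, id] using hnorm

lemma memLp_add_sq_gaussianReal (v : ℝ≥0) (m : ℝ) :
    MemLp (fun x : ℝ => (x + m) ^ 2) 2 (gaussianReal 0 v) := by
  rw [memLp_two_iff_integrable_sq (by fun_prop)]
  have hmem : MemLp (fun x : ℝ => x + m) 4 (gaussianReal 0 v) :=
    (memLp_id_gaussianReal' 4 (by simp)).add (memLp_const m)
  refine (hmem.integrable_norm_pow (by norm_num)).congr (.of_forall fun x => ?_)
  simp only [Real.norm_eq_abs]
  rw [Even.pow_abs (by decide), ← pow_mul]

lemma variance_add_sq_gaussianReal_le (v : ℝ≥0) (m : ℝ) :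
    Var[fun x : ℝ => (x + m) ^ 2; gaussianReal 0 v] ≤ 6 * v ^ 2 + 8 * m ^ 2 * v := by
  have hI4 := (integrable_pow_gaussianReal v 4).const_mul 2
  have hI2 := (integrable_pow_gaussianReal v 2).const_mul (8 * m ^ 2)
  calc Var[fun x : ℝ => (x + m) ^ 2; gaussianReal 0 v]
      = Var[fun x : ℝ => (x + m) ^ 2 - m ^ 2; gaussianReal 0 v] :=
        (variance_sub_const (X := fun x : ℝ => (x + m) ^ 2) (by fun_prop) _).symm
    _ ≤ ∫ x, ((x + m) ^ 2 - m ^ 2) ^ 2 ∂gaussianReal 0 v :=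
        variance_le_expectation_sq (by fun_prop)
    _ ≤ ∫ x, (2 * x ^ 4 + 8 * m ^ 2 * x ^ 2) ∂gaussianReal 0 v :=
        integral_mono_of_nonneg (.of_forall fun x => sq_nonneg _) (hI4.add hI2)
          (.of_forall fun x => by
            change ((x + m) ^ 2 - m ^ 2) ^ 2 ≤ 2 * x ^ 4 + 8 * m ^ 2 * x ^ 2
            nlinarith [sq_nonneg (x ^ 2 - 2 * m * x)])
    _ = 6 * v ^ 2 + 8 * m ^ 2 * v := by
        rw [integral_add hI4 hI2, integral_const_mul, integral_const_mul, integral_sq_gaussianReal,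
          integral_pow_four_gaussianReal]
        ring

variable {ι : Type*} [Fintype ι] (v : ι → ℝ≥0)

lemma lintegral_exp_mul_linear_gaussianPi (c : ι → ℝ) (s : ℝ) :
    ∫⁻ g, ENNReal.ofReal (Real.exp (s * ∑ i, c i * g i)) ∂gaussianPi v =
      ENNReal.ofReal (Real.exp (s ^ 2 / 2 * ∑ i, c i ^ 2 * v i)) := by
  rw [(hasLaw_linear_gaussianPi v c).lintegral_comp (f := fun x => .ofReal (Real.exp (s * x)))
      (by fun_prop), ← ofReal_integral_eq_lintegral_ofReal (integrable_exp_mul_gaussianReal s)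
      (.of_forall fun x => (Real.exp_pos _).le)]
  have hmgf := congrFun (mgf_id_gaussianReal (μ := 0)
    (v := (∑ i, c i ^ 2 * v i : ℝ).toNNReal)) s
  rw [Real.coe_toNNReal _ (by positivity)] at hmgf
  simp only [mgf, id_eq] at hmgf
  rw [hmgf]
  congr 2
  ring

lemma integrable_mul_eval_gaussianPi (i j : ι) :
    Integrable (fun w : ι → ℝ => w i * w j) (gaussianPi v) :=
  (memLp_eval_gaussianPi v i ENNReal.ofNat_ne_top).integrable_mul (p := 2) (q := 2)
    (memLp_eval_gaussianPi v j ENNReal.ofNat_ne_top)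

lemma integral_mul_eval_gaussianPi [DecidableEq ι] (i j : ι) :
    ∫ w, w i * w j ∂gaussianPi v = if i = j then (v i : ℝ) else 0 := by
  split_ifs with hij
  · subst hij
    simp only [← sq]
    rw [integral_comp_eval (μ := fun i => gaussianReal 0 (v i)) (f := fun x : ℝ => x ^ 2)
      (by fun_prop), integral_sq_gaussianReal]
  · have hindep := iIndepFun_pi (μ := fun i => gaussianReal 0 (v i)) (X := fun _ x => x)
      fun _ => by fun_prop
    rw [(hindep.indepFun hij).integral_fun_mul_eq_mul_integral
        (memLp_eval_gaussianPi v i ENNReal.one_ne_top).aestronglyMeasurable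
        (memLp_eval_gaussianPi v j ENNReal.one_ne_top).aestronglyMeasurable,
      integral_comp_eval (μ := fun i => gaussianReal 0 (v i)) (f := fun x : ℝ => x) (by fun_prop),
      integral_id_gaussianReal, zero_mul]

lemma dotProduct_mulVec_eq_sum (M : Matrix ι ι ℝ) (w : ι → ℝ) :
    w ⬝ᵥ M *ᵥ w = ∑ i, ∑ j, M i j * (w i * w j) := by
  simp only [dotProduct, mulVec, Finset.mul_sum]
  exact Finset.sum_congr rfl fun i _ => Finset.sum_congr rfl fun j _ => by ring

lemma add_dotProduct_mulVec_add (M : Matrix ι ι ℝ) (u w : ι → ℝ) :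
    (w + u) ⬝ᵥ M *ᵥ (w + u) =
      w ⬝ᵥ M *ᵥ w + ∑ i, (M *ᵥ u + u ᵥ* M) i * w i + u ⬝ᵥ M *ᵥ u := by
  change _ = w ⬝ᵥ M *ᵥ w + (M *ᵥ u + u ᵥ* M) ⬝ᵥ w + u ⬝ᵥ M *ᵥ u
  rw [mulVec_add, dotProduct_add, add_dotProduct, add_dotProduct, add_dotProduct,
    ← dotProduct_mulVec, dotProduct_comm (M *ᵥ u) w]
  ring

lemma integrable_quadratic_gaussianPi (M : Matrix ι ι ℝ) :
    Integrable (fun w => w ⬝ᵥ M *ᵥ w) (gaussianPi v) := by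
  simp only [dotProduct_mulVec_eq_sum]
  exact integrable_finsetSum _ fun i _ => integrable_finsetSum _ fun j _ =>
    (integrable_mul_eval_gaussianPi v i j).const_mul _

lemma integral_quadratic_gaussianPi (M : Matrix ι ι ℝ) :
    ∫ w, w ⬝ᵥ M *ᵥ w ∂gaussianPi v = ∑ i, M i i * v i := by
  classical
  have hint (i j : ι) := (integrable_mul_eval_gaussianPi v i j).const_mul (M i j)
  simp only [dotProduct_mulVec_eq_sum]
  rw [integral_finsetSum _ fun i _ => integrable_finsetSum _ fun j _ => hint i j]
  refine Finset.sum_congr rfl fun i _ => ?_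
  rw [integral_finsetSum _ fun j _ => hint i j]
  simp [integral_const_mul, integral_mul_eval_gaussianPi]

lemma integrable_quadratic_add_gaussianPi (M : Matrix ι ι ℝ) (u : ι → ℝ) :
    Integrable (fun w => (w + u) ⬝ᵥ M *ᵥ (w + u)) (gaussianPi v) := by
  simp only [add_dotProduct_mulVec_add]
  exact ((integrable_quadratic_gaussianPi v M).add
    ((memLp_linear_gaussianPi v _ ENNReal.one_ne_top).integrable le_rfl)).add (integrable_const _)

lemma integral_quadratic_add_gaussianPi (M : Matrix ι ι ℝ) (u : ι → ℝ) :
    ∫ w, (w + u) ⬝ᵥ M *ᵥ (w + u) ∂gaussianPi v = ∑ i, M i i * v i + u ⬝ᵥ M *ᵥ u := by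
  have hquad := integrable_quadratic_gaussianPi v M
  have hlin := (memLp_linear_gaussianPi v (M *ᵥ u + u ᵥ* M) ENNReal.one_ne_top).integrable le_rfl
  calc ∫ w, (w + u) ⬝ᵥ M *ᵥ (w + u) ∂gaussianPi v
      = ∫ w, (w ⬝ᵥ M *ᵥ w + ∑ i, (M *ᵥ u + u ᵥ* M) i * w i) ∂gaussianPi v + u ⬝ᵥ M *ᵥ u := by
        simp only [add_dotProduct_mulVec_add]
        refine (integral_add (hquad.add hlin) (integrable_const _)).trans ?_
        rw [integral_const, probReal_univ, one_smul]
        rfl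
    _ = ∑ i, M i i * v i + u ⬝ᵥ M *ᵥ u := by
        rw [integral_add hquad hlin, integral_quadratic_gaussianPi, integral_linear_gaussianPi,
          add_zero]

lemma memLp_dotProduct_self_add_gaussianPi (u : ι → ℝ) :
    MemLp (fun w => (w + u) ⬝ᵥ (w + u)) 2 (gaussianPi v) := by
  refine memLp_finsetSum _ fun i _ => ?_
  simp only [Pi.add_apply, ← sq]
  exact (memLp_add_sq_gaussianReal (v i) (u i)).comp_measurePreserving
    (measurePreserving_eval (fun i => gaussianReal 0 (v i)) i)

lemma integral_dotProduct_self_add_gaussianPi (u : ι → ℝ) :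
    ∫ w, (w + u) ⬝ᵥ (w + u) ∂gaussianPi v = ∑ i, (v i : ℝ) + u ⬝ᵥ u := by
  classical
  simpa using integral_quadratic_add_gaussianPi v 1 u

lemma variance_dotProduct_self_add_gaussianPi_le (u : ι → ℝ) :
    Var[fun w => (w + u) ⬝ᵥ (w + u); gaussianPi v] ≤
      ∑ i, (6 * (v i : ℝ) ^ 2 + 8 * u i ^ 2 * v i) := by
  have hsum : (∑ i, fun w : ι → ℝ => (w i + u i) ^ 2) = fun w => (w + u) ⬝ᵥ (w + u) := by
    ext w; simp [dotProduct, sq]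
  rw [← hsum, variance_sum_pi (X := fun i x => (x + u i) ^ 2) fun i =>
    memLp_add_sq_gaussianReal (v i) (u i)]
  exact Finset.sum_le_sum fun i _ => variance_add_sq_gaussianReal_le (v i) (u i)

end GaussianVector

section OperatorNormTail

open Matrix
open scoped NNReal InnerProductSpace Matrix.Norms.Frobenius

variable {d : ℕ}

/-- The law of a vector with independent `N(0, 1/d)` coordinates, the random direction that tests
the quadratic form of a GOE matrix. -/
noncomputable abbrev gaussianVector (d : ℕ) : Measure (Fin d → ℝ) :=
  gaussianPi fun _ => 1 / (d : ℝ≥0)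

lemma integral_quadratic_add_gaussianVector {M : Matrix (Fin d) (Fin d) ℝ} (hM : M.trace = 0)
    (u : Fin d → ℝ) : ∫ w, (w + u) ⬝ᵥ M *ᵥ (w + u) ∂gaussianVector d = u ⬝ᵥ M *ᵥ u := by
  rw [integral_quadratic_add_gaussianPi, ← Finset.sum_mul]
  change M.trace * _ + _ = _
  rw [hM, zero_mul, zero_add]

lemma integral_dotProduct_self_add_sq_gaussianVector_le (hd : 0 < d) {u : Fin d → ℝ}
    (hu : u ⬝ᵥ u = 1) :
    ∫ w, ((w + u) ⬝ᵥ (w + u)) ^ 2 ∂gaussianVector d ≤ 4 + 14 / d := by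
  have hd' : (d : ℝ) ≠ 0 := by positivity
  have hmean : ∫ w, (w + u) ⬝ᵥ (w + u) ∂gaussianVector d = 2 := by
    rw [integral_dotProduct_self_add_gaussianPi, hu]
    simp only [one_div, NNReal.coe_inv, NNReal.coe_natCast, Finset.sum_const, Finset.card_univ,
      Fintype.card_fin, nsmul_eq_mul, mul_inv_cancel₀ hd']
    norm_num
  have hsum : ∑ i, (6 * ((1 / (d : ℝ≥0) : ℝ≥0) : ℝ) ^ 2 +
      8 * u i ^ 2 * ((1 / (d : ℝ≥0) : ℝ≥0) : ℝ)) = (14 / d : ℝ) := by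
    have hu' : ∑ i, u i ^ 2 = 1 := by simpa only [dotProduct, ← sq] using hu
    rw [Finset.sum_add_distrib, ← Finset.sum_mul, ← Finset.sum_mul, ← Finset.mul_sum, hu']
    simp only [one_div, NNReal.coe_inv, NNReal.coe_natCast, Finset.sum_const, Finset.card_univ,
      Fintype.card_fin, nsmul_eq_mul]
    field_simp
    norm_num
  have hvar := variance_dotProduct_self_add_gaussianPi_le (fun _ => 1 / (d : ℝ≥0)) u
  rw [variance_eq_sub (memLp_dotProduct_self_add_gaussianPi _ u), hmean, hsum] at hvar
  simp only [Pi.pow_apply] at hvar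
  linarith

lemma integrable_shift_exponent_gaussianVector (u : Fin d → ℝ) :
    Integrable (fun w : Fin d → ℝ => -(d * ∑ i, u i * w i) - d / 2) (gaussianVector d) :=
  ((((memLp_linear_gaussianPi _ u ENNReal.one_ne_top).integrable le_rfl).const_mul _).neg).sub
    (integrable_const _)

lemma integral_shift_exponent_gaussianVector (u : Fin d → ℝ) :
    ∫ w, (-(d * ∑ i, u i * w i) - d / 2) ∂gaussianVector d = -(d / 2 : ℝ) := by
  refine (integral_sub ((((memLp_linear_gaussianPi _ u ENNReal.one_ne_top).integrable
    le_rfl).const_mul _).neg) (integrable_const _)).trans ?_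
  simp only [Pi.neg_apply, integral_neg, integral_const_mul, integral_linear_gaussianPi]
  simp

lemma lintegral_gaussianVector_shift (hd : 0 < d) {u : Fin d → ℝ} (hu : u ⬝ᵥ u = 1)
    {f : (Fin d → ℝ) → ENNReal} (hf : Measurable f) :
    ∫⁻ w, f w ∂gaussianVector d =
      ∫⁻ w, ENNReal.ofReal (Real.exp (-(d * ∑ i, u i * w i) - d / 2)) * f (w + u)
        ∂gaussianVector d := by
  have hd' : (d : ℝ) ≠ 0 := by positivity
  have hexponent (w : Fin d → ℝ) :
      ∑ i, (-(u i * w i / ((1 / (d : ℝ≥0) : ℝ≥0) : ℝ)) -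
        u i ^ 2 / (2 * ((1 / (d : ℝ≥0) : ℝ≥0) : ℝ))) = -(d * ∑ i, u i * w i) - d / 2 := by
    have hu' : (d / 2 : ℝ) = ∑ i, d / 2 * (u i * u i) := by
      rw [← Finset.mul_sum, ← dotProduct, hu, mul_one]
    rw [hu', Finset.mul_sum, ← Finset.sum_neg_distrib, ← Finset.sum_sub_distrib]
    refine Finset.sum_congr rfl fun i _ => ?_
    simp only [NNReal.coe_div, NNReal.coe_one, NNReal.coe_natCast]
    field_simp
  rw [lintegral_gaussianPi_shift (fun _ => by positivity) u hf]
  simp only [hexponent]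

/-- The exponential functional of the quadratic form of `goeMat g` at a random vector, with a
penalty on the length of that vector that makes its mean over the GOE at most one. -/
noncomputable def quadraticMgf (s : ℝ) (g : Sym2 (Fin d) → ℝ) : ENNReal :=
  ∫⁻ w, ENNReal.ofReal (Real.exp (s * (w ⬝ᵥ goeMat g *ᵥ w) - s ^ 2 / d * (w ⬝ᵥ w) ^ 2))
    ∂gaussianVector d

lemma continuous_quadraticMgf_integrand (s : ℝ) :
    Continuous fun p : (Sym2 (Fin d) → ℝ) × (Fin d → ℝ) =>
      Real.exp (s * (p.2 ⬝ᵥ goeMat p.1 *ᵥ p.2) - s ^ 2 / d * (p.2 ⬝ᵥ p.2) ^ 2) := by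
  have hmat : Continuous (goeMat : (Sym2 (Fin d) → ℝ) → Matrix (Fin d) (Fin d) ℝ) :=
    goeMat.continuous_of_finiteDimensional
  have hquad : Continuous fun p : (Sym2 (Fin d) → ℝ) × (Fin d → ℝ) =>
      p.2 ⬝ᵥ goeMat p.1 *ᵥ p.2 :=
    continuous_snd.dotProduct ((hmat.comp continuous_fst).matrix_mulVec continuous_snd)
  have hsq : Continuous fun p : (Sym2 (Fin d) → ℝ) × (Fin d → ℝ) => p.2 ⬝ᵥ p.2 :=
    continuous_snd.dotProduct continuous_snd
  exact Real.continuous_exp.comp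
    ((continuous_const.mul hquad).sub (continuous_const.mul (hsq.pow 2)))

lemma measurable_quadraticMgf (s : ℝ) : Measurable (quadraticMgf (d := d) s) :=
  (continuous_quadraticMgf_integrand s).measurable.ennreal_ofReal.lintegral_prod_right

lemma lintegral_exp_inner_goeMat {X : Matrix (Fin d) (Fin d) ℝ} (hX : X.IsSymm) (s : ℝ) :
    ∫⁻ g, ENNReal.ofReal (Real.exp (s * ⟪goeMat g, X⟫_ℝ)) ∂goeEntries d =
      ENNReal.ofReal (Real.exp (s ^ 2 / d * ‖center X‖ ^ 2)) := by
  simp only [inner_goeMat hX, lintegral_exp_mul_linear_gaussianPi, sum_goeCoeff_sq hX]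
  congr 2
  ring

lemma lintegral_exp_quadratic_sub_penalty_le_one (s : ℝ) (w : Fin d → ℝ) :
    ∫⁻ g, ENNReal.ofReal (Real.exp (s * (w ⬝ᵥ goeMat g *ᵥ w) - s ^ 2 / d * (w ⬝ᵥ w) ^ 2))
      ∂goeEntries d ≤ 1 := by
  have hX : (vecMulVec w w).IsSymm := transpose_vecMulVec w w
  simp only [sub_eq_add_neg, Real.exp_add, ENNReal.ofReal_mul (Real.exp_pos _).le,
    dotProduct_mulVec_eq_inner]
  rw [lintegral_mul_const' _ _ ENNReal.ofReal_ne_top, lintegral_exp_inner_goeMat hX,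
    ← ENNReal.ofReal_mul (Real.exp_pos _).le, ← Real.exp_add, ENNReal.ofReal_le_one,
    Real.exp_le_one_iff, ← frobenius_norm_vecMulVec, ← sub_eq_add_neg, sub_nonpos]
  gcongr
  exact norm_center_le _

lemma lintegral_quadraticMgf_le_one (s : ℝ) : ∫⁻ g, quadraticMgf s g ∂goeEntries d ≤ 1 := by
  unfold quadraticMgf
  rw [lintegral_lintegral_swap
    (continuous_quadraticMgf_integrand s).measurable.ennreal_ofReal.aemeasurable]
  calc _ ≤ ∫⁻ _, 1 ∂gaussianVector d :=
        lintegral_mono (lintegral_exp_quadratic_sub_penalty_le_one s)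
    _ = 1 := by simp

/- Translating the random direction by `u` costs `d / 2` in the exponent, and Jensen's inequality
then replaces the quadratic form by its value at `u`. -/
lemma le_quadraticMgf (hd : 0 < d) (s : ℝ) (g : Sym2 (Fin d) → ℝ) {u : Fin d → ℝ}
    (hu : u ⬝ᵥ u = 1) :
    ENNReal.ofReal (Real.exp (s * (u ⬝ᵥ goeMat g *ᵥ u) - s ^ 2 / d * (4 + 14 / d) - d / 2)) ≤
      quadraticMgf s g := by
  have hmeas : Measurable fun w : Fin d → ℝ => ENNReal.ofReal (Real.exp
      (s * (w ⬝ᵥ goeMat g *ᵥ w) - s ^ 2 / d * (w ⬝ᵥ w) ^ 2)) :=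
    ((continuous_quadraticMgf_integrand s).comp
      (Continuous.prodMk_right g)).measurable.ennreal_ofReal
  have hshift := integrable_shift_exponent_gaussianVector u
  have hquad : Integrable (fun w => s * ((w + u) ⬝ᵥ goeMat g *ᵥ (w + u))) (gaussianVector d) :=
    (integrable_quadratic_add_gaussianPi _ (goeMat g) u).const_mul s
  have hpenalty : Integrable (fun w => s ^ 2 / d * ((w + u) ⬝ᵥ (w + u)) ^ 2)
      (gaussianVector d) :=
    (memLp_dotProduct_self_add_gaussianPi _ u).integrable_sq.const_mul _
  have hdiff : Integrable (fun w => s * ((w + u) ⬝ᵥ goeMat g *ᵥ (w + u)) -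
      s ^ 2 / d * ((w + u) ⬝ᵥ (w + u)) ^ 2) (gaussianVector d) := hquad.sub hpenalty
  rw [quadraticMgf, lintegral_gaussianVector_shift hd hu hmeas]
  simp_rw [← ENNReal.ofReal_mul (Real.exp_pos _).le, ← Real.exp_add]
  refine le_trans (ENNReal.ofReal_le_ofReal (Real.exp_le_exp.2 ?_))
    (ofReal_exp_integral_le_lintegral (hshift.add hdiff))
  rw [integral_add hshift hdiff, integral_sub hquad hpenalty, integral_const_mul,
    integral_const_mul, integral_shift_exponent_gaussianVector,
    integral_quadratic_add_gaussianVector (trace_goeMat g)]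
  have hmoment := mul_le_mul_of_nonneg_left
    (integral_dotProduct_self_add_sq_gaussianVector_le hd hu) (by positivity : 0 ≤ s ^ 2 / d)
  linarith

lemma exp_le_quadraticMgf (hd : 0 < d) {σ : ℝ} (hσ : σ ^ 2 = 1) {g : Sym2 (Fin d) → ℝ}
    {u : Fin d → ℝ} (hu : u ⬝ᵥ u = 1) (hg : 29 / 10 ≤ σ * (u ⬝ᵥ goeMat g *ᵥ u)) :
    ENNReal.ofReal (Real.exp (d / 40 - 2)) ≤ quadraticMgf (σ * (29 / 80 * d)) g := by
  refine le_trans (ENNReal.ofReal_le_ofReal (Real.exp_le_exp.2 ?_)) (le_quadraticMgf hd _ g hu)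
  have hpenalty : (σ * (29 / 80 * d)) ^ 2 / d * (4 + 14 / d) = (29 / 80) ^ 2 * (4 * d + 14) := by
    rw [mul_pow, hσ]; field_simp
  have hquad := mul_le_mul_of_nonneg_left hg (by positivity : (0 : ℝ) ≤ 29 / 80 * d)
  rw [hpenalty]
  linarith [(Nat.cast_nonneg d : (0 : ℝ) ≤ d)]

lemma measure_exists_quadratic_ge_le (hd : 0 < d) {σ : ℝ} (hσ : σ ^ 2 = 1) :
    goeEntries d {g | ∃ u : Fin d → ℝ, u ⬝ᵥ u = 1 ∧ 29 / 10 ≤ σ * (u ⬝ᵥ goeMat g *ᵥ u)} ≤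
      ENNReal.ofReal (Real.exp (2 - d / 40)) := by
  set s : ℝ := σ * (29 / 80 * d)
  set T : ENNReal := .ofReal (Real.exp (d / 40 - 2)) with hT
  calc _ ≤ goeEntries d {g | T ≤ quadraticMgf s g} :=
        measure_mono <| by rintro g ⟨u, hu, hg⟩; exact exp_le_quadraticMgf hd hσ hu hg
    _ ≤ (∫⁻ g, quadraticMgf s g ∂goeEntries d) / T :=
        meas_ge_le_lintegral_div (measurable_quadraticMgf s).aemeasurable
          (ENNReal.ofReal_pos.2 (Real.exp_pos _)).ne' ENNReal.ofReal_ne_top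
    _ ≤ 1 / T := by gcongr; exact lintegral_quadraticMgf_le_one s
    _ = ENNReal.ofReal (Real.exp (2 - d / 40)) := by
        rw [one_div, hT, ← ENNReal.ofReal_inv_of_pos (Real.exp_pos _), ← Real.exp_neg, neg_sub]

end OperatorNormTail

section FrobeniusTail

open Matrix
open scoped NNReal InnerProductSpace Matrix.Norms.Frobenius

variable {d : ℕ}

/-- The number of off-diagonal matrix positions that carry an unordered pair of indices. -/
def offDiagMultiplicity (p : Sym2 (Fin d)) : ℝ := if p.IsDiag then 0 else 2

lemma sum_sum_offDiag_sym2 (F : Sym2 (Fin d) → ℝ) :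
    ∑ i, ∑ j, (if i = j then 0 else F s(i, j)) = ∑ p, offDiagMultiplicity p * F p := by
  have hcongr := sum_sum_sym2 fun p : Sym2 (Fin d) => if p.IsDiag then 0 else F p
  simp only [Sym2.mk_isDiag_iff] at hcongr
  rw [hcongr]
  refine Finset.sum_congr rfl fun p _ => ?_
  unfold pairMultiplicity offDiagMultiplicity
  split_ifs <;> ring

lemma sum_offDiagMultiplicity : ∑ p : Sym2 (Fin d), offDiagMultiplicity p = d * (d - 1) := by
  have hcount := sum_sum_offDiag_sym2 (d := d) fun _ => 1
  simp only [mul_one] at hcount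
  rw [← hcount]
  have hite (i j : Fin d) : (if i = j then (0 : ℝ) else 1) = 1 - if i = j then 1 else 0 := by
    split_ifs <;> norm_num
  simp only [hite, Finset.sum_sub_distrib, Finset.sum_const, Finset.card_univ, Fintype.card_fin,
    nsmul_eq_mul, mul_one, Finset.sum_ite_eq, Finset.mem_univ, if_true]
  ring

lemma sum_offDiagMultiplicity_mul_sq_le (g : Sym2 (Fin d) → ℝ) :
    ∑ p, offDiagMultiplicity p * g p ^ 2 ≤ ‖goeMat g‖ ^ 2 := by
  rw [← sum_sum_offDiag_sym2 fun p => g p ^ 2, frobenius_norm_sq_eq_sum]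
  refine Finset.sum_le_sum fun i _ => Finset.sum_le_sum fun j _ => ?_
  split_ifs with hij
  · positivity
  · simp [goeMat_apply, center_apply, symMat_apply, hij]

lemma offDiagMultiplicity_mul_goeVar (p : Sym2 (Fin d)) :
    offDiagMultiplicity p * goeVar d p = 1 / d * offDiagMultiplicity p := by
  unfold offDiagMultiplicity goeVar
  split_ifs <;> simp [mul_comm]

lemma offDiagMultiplicity_sq (p : Sym2 (Fin d)) :
    offDiagMultiplicity p ^ 2 = 2 * offDiagMultiplicity p := by
  unfold offDiagMultiplicity
  split_ifs <;> norm_num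

lemma memLp_mul_sq_gaussianReal (a : ℝ) (v : ℝ≥0) :
    MemLp (fun x : ℝ => a * x ^ 2) 2 (gaussianReal 0 v) := by
  simpa using (memLp_add_sq_gaussianReal v 0).const_mul a

lemma memLp_offDiagMultiplicity_mul_sq (p : Sym2 (Fin d)) :
    MemLp (fun g : Sym2 (Fin d) → ℝ => offDiagMultiplicity p * g p ^ 2) 2 (goeEntries d) :=
  (memLp_mul_sq_gaussianReal _ _).comp_measurePreserving
    (measurePreserving_eval (fun p => gaussianReal 0 (goeVar d p)) p)

lemma integral_sum_offDiagMultiplicity_mul_sq (hd : 0 < d) :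
    ∫ g, ∑ p, offDiagMultiplicity p * g p ^ 2 ∂goeEntries d = d - 1 := by
  have hterm (p : Sym2 (Fin d)) : ∫ g, offDiagMultiplicity p * g p ^ 2 ∂goeEntries d =
      1 / d * offDiagMultiplicity p := by
    rw [integral_const_mul, integral_comp_eval (μ := fun p => gaussianReal 0 (goeVar d p))
      (f := fun x : ℝ => x ^ 2) (by fun_prop), integral_sq_gaussianReal,
      offDiagMultiplicity_mul_goeVar]
  rw [integral_finsetSum _ fun p _ => (memLp_offDiagMultiplicity_mul_sq p).integrable one_le_two]
  simp only [hterm]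
  rw [← Finset.mul_sum, sum_offDiagMultiplicity]
  field_simp

lemma variance_sq_gaussianReal_le (v : ℝ≥0) :
    Var[fun x : ℝ => x ^ 2; gaussianReal 0 v] ≤ 3 * v ^ 2 := by
  refine (variance_le_expectation_sq (by fun_prop)).trans_eq ?_
  simp only [Pi.pow_apply, ← pow_mul]
  exact integral_pow_four_gaussianReal v

lemma variance_sum_offDiagMultiplicity_mul_sq_le (hd : 0 < d) :
    Var[fun g => ∑ p, offDiagMultiplicity p * g p ^ 2; goeEntries d] ≤ 6 := by
  have hd' : (0 : ℝ) < d := by positivity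
  have hterm (p : Sym2 (Fin d)) :
      Var[fun x : ℝ => offDiagMultiplicity p * x ^ 2; gaussianReal 0 (goeVar d p)] ≤
        6 / (d : ℝ) ^ 2 * offDiagMultiplicity p := by
    rw [variance_const_mul]
    calc offDiagMultiplicity p ^ 2 * Var[fun x : ℝ => x ^ 2; gaussianReal 0 (goeVar d p)]
        ≤ offDiagMultiplicity p ^ 2 * (3 * goeVar d p ^ 2) := by
          gcongr; exact variance_sq_gaussianReal_le _
      _ = 3 * (offDiagMultiplicity p * goeVar d p) ^ 2 := by ring
      _ = 3 * (1 / d) ^ 2 * offDiagMultiplicity p ^ 2 := by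
          rw [offDiagMultiplicity_mul_goeVar]; ring
      _ = 6 / (d : ℝ) ^ 2 * offDiagMultiplicity p := by rw [offDiagMultiplicity_sq]; ring
  rw [← Finset.sum_fn, variance_sum_pi fun p => memLp_mul_sq_gaussianReal _ _]
  calc _ ≤ ∑ p : Sym2 (Fin d), 6 / (d : ℝ) ^ 2 * offDiagMultiplicity p :=
        Finset.sum_le_sum fun p _ => hterm p
    _ = 6 * ((d - 1) / d) := by
        rw [← Finset.mul_sum, sum_offDiagMultiplicity]; field_simp
    _ ≤ 6 := by
        have : ((d : ℝ) - 1) / d ≤ 1 := by rw [div_le_one hd']; linarith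
        linarith

lemma measure_norm_goeMat_sq_lt_le (hd : 4 ≤ d) :
    goeEntries d {g | ‖goeMat g‖ ^ 2 < d / 2} ≤ ENNReal.ofReal (96 / d) := by
  have hd4 : (4 : ℝ) ≤ d := by exact_mod_cast hd
  have hmem : MemLp (fun g : Sym2 (Fin d) → ℝ => ∑ p, offDiagMultiplicity p * g p ^ 2) 2
      (goeEntries d) := memLp_finsetSum _ fun p _ => memLp_offDiagMultiplicity_mul_sq p
  refine (measure_mono fun g hg => ?_).trans ((meas_ge_le_variance_div_sq hmem
    (by positivity : (0 : ℝ) < d / 4)).trans (ENNReal.ofReal_le_ofReal ?_))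
  · have hg' : ‖goeMat g‖ ^ 2 < d / 2 := hg
    change (d / 4 : ℝ) ≤ _
    rw [integral_sum_offDiagMultiplicity_mul_sq (by omega), abs_sub_comm]
    exact le_trans (by linarith [sum_offDiagMultiplicity_mul_sq_le g]) (le_abs_self _)
  · calc _ ≤ 6 / ((d : ℝ) / 4) ^ 2 := by
          gcongr; exact variance_sum_offDiagMultiplicity_mul_sq_le (by omega)
      _ = 96 / d * (1 / d) := by field_simp; norm_num
      _ ≤ 96 / d * 1 := by gcongr; rw [div_le_one (by positivity)]; linarith
      _ = 96 / d := mul_one _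

end FrobeniusTail

section TypicalSet

open Matrix
open scoped NNReal InnerProductSpace Matrix.Norms.Frobenius

variable {d : ℕ}

/-- The entries of the trace-centered GOE matrices whose operator norm is at most `t` and whose
squared Frobenius norm is at least `b`. -/
def goeRegion (d : ℕ) (t b : ℝ) : Set (Sym2 (Fin d) → ℝ) :=
  {g | (∀ x : Fin d → ℝ, |x ⬝ᵥ goeMat g *ᵥ x| ≤ t * (x ⬝ᵥ x)) ∧ b ≤ ‖goeMat g‖ ^ 2}

lemma measurableSet_goeRegion (t b : ℝ) : MeasurableSet (goeRegion d t b) := by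
  have hmat : Continuous (goeMat : (Sym2 (Fin d) → ℝ) → Matrix (Fin d) (Fin d) ℝ) :=
    goeMat.continuous_of_finiteDimensional
  have hquad (x : Fin d → ℝ) : Continuous fun g => |x ⬝ᵥ goeMat g *ᵥ x| :=
    (continuous_const.dotProduct (hmat.matrix_mulVec continuous_const)).abs
  rw [goeRegion, Set.ofPred_and, Set.ofPred_forall]
  exact ((isClosed_iInter fun x => isClosed_le (hquad x) continuous_const).inter
    (isClosed_le continuous_const (hmat.norm.pow 2))).measurableSet

lemma goeRegion_subset {t t' b b' : ℝ} (ht : t ≤ t') (hb : b' ≤ b) :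
    goeRegion d t b ⊆ goeRegion d t' b' := fun _ hg =>
  ⟨fun x => (hg.1 x).trans (mul_le_mul_of_nonneg_right ht (dotProduct_star_self_nonneg x)),
    hb.trans hg.2⟩

lemma neg_mem_goeRegion {t b : ℝ} {g : Sym2 (Fin d) → ℝ} :
    -g ∈ goeRegion d t b ↔ g ∈ goeRegion d t b := by
  simp [goeRegion, map_neg, neg_mulVec]

lemma setIntegral_goeRegion_of_odd {t b : ℝ} {f : (Sym2 (Fin d) → ℝ) → ℝ}
    (hf : ∀ g, f (-g) = -f g) : ∫ g in goeRegion d t b, f g ∂goeEntries d = 0 := by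
  have hneg := (measurePreserving_neg_gaussianPi (goeVar d)).setIntegral_preimage_emb
    (MeasurableEquiv.neg (Sym2 (Fin d) → ℝ)).measurableEmbedding f (goeRegion d t b)
  have hpreimage : (fun g => -g) ⁻¹' goeRegion d t b = goeRegion d t b :=
    Set.ext fun _ => neg_mem_goeRegion
  simp only [hpreimage, hf, integral_neg] at hneg
  linarith

lemma add_symEntries_mem_goeRegion {t b r c : ℝ} {g : Sym2 (Fin d) → ℝ}
    (hg : g ∈ goeRegion d t b) {H : Matrix (Fin d) (Fin d) ℝ} (hH : H.IsSymm) (htr : H.trace = 0)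
    (hr : ‖H‖ ≤ r) (hc : ‖H‖ + c ≤ √b) (hc0 : 0 ≤ c) :
    g + symEntries H ∈ goeRegion d (t + r) (c ^ 2) := by
  rw [goeRegion, Set.mem_ofPred_eq, goeMat_add_symEntries hH htr]
  refine ⟨fun x => ?_, ?_⟩
  · have hHx : |x ⬝ᵥ H *ᵥ x| ≤ r * (x ⬝ᵥ x) :=
      (abs_dotProduct_mulVec_le_frobenius_norm H x).trans
        (mul_le_mul_of_nonneg_right hr (dotProduct_star_self_nonneg x))
    rw [add_mulVec, dotProduct_add]
    exact (abs_add_le _ _).trans (by linarith [hg.1 x])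
  · have hM : √b ≤ ‖goeMat g‖ := Real.sqrt_le_iff.2 ⟨norm_nonneg _, hg.2⟩
    have htriangle : ‖goeMat g‖ ≤ ‖goeMat g + H‖ + ‖H‖ := by
      simpa using norm_sub_le (goeMat g + H) H
    gcongr
    linarith

/-- The entries of the trace-centered GOE matrices that satisfy the truncation condition. -/
abbrev truncatedEntries (d : ℕ) : Set (Sym2 (Fin d) → ℝ) := goeRegion d 3 (d / 4)

lemma goeMat_mem_truncationSet_iff (g : Sym2 (Fin d) → ℝ) :
    goeMat g ∈ truncationSet d ↔ g ∈ truncatedEntries d := by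
  simp only [truncationSet, goeRegion, Set.mem_ofPred_eq, frobenius_norm_sq_eq_sum,
    norm_toEuclideanCLM_le_iff (goeMat_isSymm g) (by norm_num : (0 : ℝ) ≤ 3)]

/-- A symmetric event of high probability that stays in the truncation event under small shifts. -/
abbrev typicalSet (d : ℕ) : Set (Sym2 (Fin d) → ℝ) := goeRegion d (29 / 10) (d / 2)

lemma typicalSet_subset_truncatedEntries (d : ℕ) : typicalSet d ⊆ truncatedEntries d :=
  goeRegion_subset (by norm_num) (by linarith [(Nat.cast_nonneg d : (0 : ℝ) ≤ d)])

lemma add_symEntries_mem_truncatedEntries (hd : 0 < d) {g : Sym2 (Fin d) → ℝ}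
    (hg : g ∈ typicalSet d) {H : Matrix (Fin d) (Fin d) ℝ} (hH : H.IsSymm) (htr : H.trace = 0)
    (hnorm : ‖H‖ ≤ 1 / 10) : g + symEntries H ∈ truncatedEntries d := by
  have hd1 : (1 : ℝ) ≤ d := by exact_mod_cast hd
  have hsqrt : ‖H‖ + √d / 2 ≤ √(d / 2) := by
    have hsq : (√d) ^ 2 = d := Real.sq_sqrt (Nat.cast_nonneg d)
    have hsqrt1 : 1 ≤ √d := Real.one_le_sqrt.2 hd1
    refine Real.le_sqrt_of_sq_le ?_
    nlinarith [norm_nonneg H]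
  have hmem := add_symEntries_mem_goeRegion hg hH htr hnorm hsqrt (by positivity)
  rw [div_pow, Real.sq_sqrt (Nat.cast_nonneg d)] at hmem
  norm_num at hmem
  exact hmem

lemma exists_unit_quadratic_eq (M : Matrix (Fin d) (Fin d) ℝ) {x : Fin d → ℝ} (hx : x ≠ 0) :
    ∃ u : Fin d → ℝ, u ⬝ᵥ u = 1 ∧ x ⬝ᵥ M *ᵥ x = (u ⬝ᵥ M *ᵥ u) * (x ⬝ᵥ x) := by
  have hpos : 0 < x ⬝ᵥ x := by simpa using dotProduct_star_self_pos_iff.2 hx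
  have hinv : (√(x ⬝ᵥ x))⁻¹ * (√(x ⬝ᵥ x))⁻¹ = (x ⬝ᵥ x)⁻¹ := by
    rw [← mul_inv, Real.mul_self_sqrt hpos.le]
  refine ⟨(√(x ⬝ᵥ x))⁻¹ • x, ?_, ?_⟩
  · rw [smul_dotProduct, dotProduct_smul, smul_smul, hinv, smul_eq_mul, inv_mul_cancel₀ hpos.ne']
  · rw [mulVec_smul, smul_dotProduct, dotProduct_smul, smul_smul, hinv, smul_eq_mul]
    field_simp

lemma typicalSet_compl_subset (d : ℕ) :
    (typicalSet d)ᶜ ⊆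
      {g | ∃ u : Fin d → ℝ, u ⬝ᵥ u = 1 ∧ 29 / 10 ≤ 1 * (u ⬝ᵥ goeMat g *ᵥ u)} ∪
      {g | ∃ u : Fin d → ℝ, u ⬝ᵥ u = 1 ∧ 29 / 10 ≤ -1 * (u ⬝ᵥ goeMat g *ᵥ u)} ∪
      {g | ‖goeMat g‖ ^ 2 < d / 2} := by
  intro g hg
  by_contra! hnot
  simp only [Set.mem_union, not_or, Set.mem_ofPred_eq, not_lt, not_exists, not_and, not_le]
    at hnot
  obtain ⟨⟨hupper, hlower⟩, hnorm⟩ := hnot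
  refine hg ⟨fun x => ?_, hnorm⟩
  rcases eq_or_ne x 0 with rfl | hx
  · simp
  · obtain ⟨u, hu, hquad⟩ := exists_unit_quadratic_eq (goeMat g) hx
    have hx0 : 0 ≤ x ⬝ᵥ x := dotProduct_star_self_nonneg x
    rw [hquad, abs_mul, abs_of_nonneg hx0]
    refine mul_le_mul_of_nonneg_right (abs_le.2 ⟨?_, ?_⟩) hx0
    · linarith [hlower u hu]
    · linarith [hupper u hu]

/-- The constant in the probability bound for the complement of `typicalSet`. -/
noncomputable def typicalConst : ℝ := 96 + 80 * Real.exp 2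

lemma typicalConst_pos : 0 < typicalConst := by unfold typicalConst; positivity

lemma measure_typicalSet_compl_le (hd : 4 ≤ d) :
    (goeEntries d).real (typicalSet d)ᶜ ≤ typicalConst / d := by
  have hd0 : 0 < d := by omega
  have hd' : (0 : ℝ) < d := by positivity
  have hexp : Real.exp (2 - d / 40) ≤ 40 * Real.exp 2 / d := by
    rw [Real.exp_sub, div_le_div_iff₀ (Real.exp_pos _) hd']
    nlinarith [Real.add_one_le_exp ((d : ℝ) / 40), Real.exp_pos 2]
  refine ENNReal.toReal_le_of_le_ofReal (by have := typicalConst_pos; positivity) ?_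
  calc goeEntries d (typicalSet d)ᶜ
      ≤ _ + _ + goeEntries d {g | ‖goeMat g‖ ^ 2 < d / 2} :=
        (measure_mono (typicalSet_compl_subset d)).trans ((measure_union_le _ _).trans
          (add_le_add_left (measure_union_le _ _) _))
    _ ≤ .ofReal (Real.exp (2 - d / 40)) + .ofReal (Real.exp (2 - d / 40)) + .ofReal (96 / d) :=
        add_le_add (add_le_add (measure_exists_quadratic_ge_le hd0 (by norm_num))
          (measure_exists_quadratic_ge_le hd0 (by norm_num))) (measure_norm_goeMat_sq_lt_le hd)
    _ = .ofReal (2 * Real.exp (2 - d / 40) + 96 / d) := by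
        rw [← ENNReal.ofReal_add (by positivity) (by positivity),
          ← ENNReal.ofReal_add (by positivity) (by positivity), two_mul]
    _ ≤ ENNReal.ofReal (typicalConst / d) := by
        refine ENNReal.ofReal_le_ofReal ?_
        have hconst : typicalConst / d = 96 / d + 2 * (40 * Real.exp 2 / d) := by
          unfold typicalConst; ring
        linarith

end TypicalSet

section LikelihoodRatio

open Matrix
open scoped InnerProductSpace Matrix.Norms.Frobenius

lemma sub_sq_sub_abs_cube_le_log {u : ℝ} (hu : |u| ≤ 1 / 2) :
    u - u ^ 2 / 2 - 2 * |u| ^ 3 ≤ Real.log (1 + u) := by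
  have hneg : |(-u)| < 1 := by rw [abs_neg]; linarith
  have htaylor := Real.abs_log_sub_add_sum_range_le hneg 2
  rw [abs_neg, sub_neg_eq_add] at htaylor
  norm_num [Finset.sum_range_succ] at htaylor
  have hremainder : |u| ^ 3 / (1 - |u|) ≤ 2 * |u| ^ 3 := by
    rw [div_le_iff₀ (by linarith)]
    nlinarith [pow_nonneg (abs_nonneg u) 3]
  linarith [(abs_le.1 htaylor).1]

lemma abs_cube_le_sq_add_pow_four {r : ℝ} (hr : 0 < r) (a : ℝ) :
    |a| ^ 3 ≤ (r⁻¹ * a ^ 2 + r * a ^ 4) / 2 := by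
  have hsquare : (r⁻¹ * |a| ^ 2 + r * |a| ^ 4) / 2 - |a| ^ 3
      = r⁻¹ * (|a| - r * |a| ^ 2) ^ 2 / 2 := by
    field_simp; ring
  have hnonneg : 0 ≤ r⁻¹ * (|a| - r * |a| ^ 2) ^ 2 / 2 := by positivity
  rw [← sq_abs a, ← Even.pow_abs (by decide : Even 4) a]
  linarith

/-- The even terms in `a` that are subtracted in a lower bound for `log (1 + ε * (a + h))`. The
cubic remainder is made even by `2 |a|³ ≤ a² / r + r a⁴`, where `r` can be chosen freely. -/
noncomputable def logPenalty (ε r a : ℝ) : ℝ :=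
  (ε ^ 2 / 2 + 4 * ε ^ 3 * r⁻¹) * a ^ 2 + 4 * ε ^ 3 * r * a ^ 4

lemma exp_sub_logPenalty_le_one_add {ε a h r : ℝ} (hε : 0 ≤ ε) (hε' : ε ≤ 1 / 12) (hr : 0 < r)
    (hu : |ε * (a + h)| ≤ 1 / 2) (hh : |h| ≤ 1 / 5) :
    Real.exp ((ε * h - ε ^ 2 * h ^ 2) + (ε - ε ^ 2 * h) * a - logPenalty ε r a) ≤
      1 + ε * (a + h) := by
  rw [← Real.le_log_iff_exp_le (by linarith [(abs_le.1 hu).1])]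
  refine le_trans ?_ (sub_sq_sub_abs_cube_le_log hu)
  have hε3 : 0 ≤ ε ^ 3 := by positivity
  have hcube : |ε * (a + h)| ^ 3 ≤ ε ^ 3 * (4 * (|a| ^ 3 + |h| ^ 3)) := by
    rw [abs_mul, mul_pow, abs_of_nonneg hε]
    refine mul_le_mul_of_nonneg_left ?_ hε3
    calc |a + h| ^ 3 ≤ (|a| + |h|) ^ 3 := by gcongr; exact abs_add_le a h
      _ ≤ 2 ^ (3 - 1) * (|a| ^ 3 + |h| ^ 3) := add_pow_le (abs_nonneg a) (abs_nonneg h) 3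
      _ = 4 * (|a| ^ 3 + |h| ^ 3) := by norm_num
  have hcube_a := mul_le_mul_of_nonneg_left (abs_cube_le_sq_add_pow_four hr a) hε3
  have hcube_h : ε ^ 3 * (8 * |h| ^ 3) ≤ ε ^ 2 * h ^ 2 / 2 := by
    have hεh : ε * |h| ≤ 1 / 12 * (1 / 5) := mul_le_mul hε' hh (abs_nonneg h) (by norm_num)
    calc ε ^ 3 * (8 * |h| ^ 3) = ε ^ 2 * h ^ 2 * (8 * (ε * |h|)) := by rw [← sq_abs h]; ring
      _ ≤ ε ^ 2 * h ^ 2 * (1 / 2) := by gcongr; linarith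
      _ = ε ^ 2 * h ^ 2 / 2 := by ring
  unfold logPenalty
  nlinarith

lemma ofReal_mul_exp_le_setLIntegral {Ω : Type*} [MeasurableSpace Ω] {μ : Measure Ω}
    [IsFiniteMeasure μ] {V : Set Ω} (hV : 0 < μ.real V) {φ : Ω → ℝ} (hφ : Integrable φ μ) :
    ENNReal.ofReal (μ.real V * Real.exp ((μ.real V)⁻¹ * ∫ x in V, φ x ∂μ)) ≤
      ∫⁻ x in V, ENNReal.ofReal (Real.exp (φ x)) ∂μ := by
  have hV0 : μ V ≠ 0 := fun h => by simp [Measure.real, h] at hV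
  have : IsProbabilityMeasure (cond μ V) := cond_isProbabilityMeasure hV0
  have hcond : ∫ x, φ x ∂cond μ V = (μ.real V)⁻¹ * ∫ x in V, φ x ∂μ := by
    rw [ProbabilityTheory.cond, integral_smul_measure, ENNReal.toReal_inv]; rfl
  have hjensen := ofReal_exp_integral_le_lintegral (μ := cond μ V)
    (hφ.restrict.smul_measure (ENNReal.inv_ne_top.2 hV0))
  rw [hcond, ProbabilityTheory.cond, lintegral_smul_measure, smul_eq_mul] at hjensen
  calc ENNReal.ofReal (μ.real V * Real.exp ((μ.real V)⁻¹ * ∫ x in V, φ x ∂μ))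
      = μ V * ENNReal.ofReal (Real.exp ((μ.real V)⁻¹ * ∫ x in V, φ x ∂μ)) := by
        rw [ENNReal.ofReal_mul hV.le, ofReal_measureReal]
    _ ≤ μ V * ((μ V)⁻¹ * ∫⁻ x in V, ENNReal.ofReal (Real.exp (φ x)) ∂μ) := by gcongr
    _ = ∫⁻ x in V, ENNReal.ofReal (Real.exp (φ x)) ∂μ := by
        rw [← mul_assoc, ENNReal.mul_inv_cancel hV0 (measure_ne_top _ _), one_mul]

variable {d n : ℕ}

lemma setLIntegral_shift_le (hd : 0 < d) {H : Matrix (Fin d) (Fin d) ℝ} (hH : H.IsSymm)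
    (htr : H.trace = 0) (hnorm : ‖H‖ ≤ 1 / 10) {f : (Sym2 (Fin d) → ℝ) → ENNReal}
    (hf : Measurable f) :
    ∫⁻ g in typicalSet d, ENNReal.ofReal
        (Real.exp (-(d / 2 * ⟪goeMat g, H⟫_ℝ) - d / 4 * ‖H‖ ^ 2)) * f (g + symEntries H)
        ∂goeEntries d ≤
      ∫⁻ g in truncatedEntries d, f g ∂goeEntries d := by
  have htrunc : MeasurableSet (truncatedEntries d) := measurableSet_goeRegion _ _
  rw [← lintegral_indicator htrunc, lintegral_goeEntries_shift hd hH htr (hf.indicator htrunc)]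
  refine (setLIntegral_mono' (measurableSet_goeRegion _ _) fun g hg => ?_).trans
    (setLIntegral_le_lintegral _ _)
  rw [Set.indicator_of_mem (add_symEntries_mem_truncatedEntries hd hg hH htr hnorm)]

lemma norm_center_le_two {y : Matrix (Fin d) (Fin d) ℝ} (hy : y.PosSemidef) (htr : y.trace ≤ 2) :
    ‖center y‖ ≤ 2 :=
  (norm_center_le y).trans ((frobenius_norm_le_trace hy).trans htr)

lemma abs_inner_le_of_trace_eq_zero {y H : Matrix (Fin d) (Fin d) ℝ} (hy : y.PosSemidef)
    (htr : y.trace ≤ 2) (hH : H.trace = 0) (hnorm : ‖H‖ ≤ 1 / 10) : |⟪H, y⟫_ℝ| ≤ 1 / 5 := by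
  rw [← center_of_trace_eq_zero hH, inner_center_left]
  calc |⟪H, center y⟫_ℝ| ≤ ‖H‖ * ‖center y‖ := abs_real_inner_le_norm _ _
    _ ≤ 1 / 10 * 2 := by gcongr; exact norm_center_le_two hy htr
    _ = 1 / 5 := by norm_num

lemma exp_sub_logPenalty_le_likelihood (hd : 0 < d) {ε r : ℝ} (hε : 0 ≤ ε) (hε' : ε ≤ 1 / 12)
    (hr : 0 < r) {y H : Matrix (Fin d) (Fin d) ℝ} (hy : y.PosSemidef) (hytr : y.trace ≤ 2)
    (hH : H.IsSymm) (htr : H.trace = 0) (hnorm : ‖H‖ ≤ 1 / 10) {g : Sym2 (Fin d) → ℝ}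
    (hg : g ∈ typicalSet d) :
    Real.exp ((ε * ⟪H, y⟫_ℝ - ε ^ 2 * ⟪H, y⟫_ℝ ^ 2) + (ε - ε ^ 2 * ⟪H, y⟫_ℝ) * ⟪goeMat g, y⟫_ℝ
      - logPenalty ε r ⟪goeMat g, y⟫_ℝ) ≤ 1 + ε * ⟪goeMat (g + symEntries H), y⟫_ℝ := by
  have hbound := abs_inner_le_mul_trace hy
    (add_symEntries_mem_truncatedEntries hd hg hH htr hnorm).1
  rw [goeMat_add_symEntries hH htr, inner_add_left] at hbound ⊢
  refine exp_sub_logPenalty_le_one_add hε hε' hr ?_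
    (abs_inner_le_of_trace_eq_zero hy hytr htr hnorm)
  rw [abs_mul, abs_of_nonneg hε]
  calc ε * |⟪goeMat g, y⟫_ℝ + ⟪H, y⟫_ℝ| ≤ 1 / 12 * 6 := by
        gcongr
        linarith
    _ = 1 / 2 := by norm_num

lemma integrable_logPenalty (ε r : ℝ) {y : Matrix (Fin d) (Fin d) ℝ} (hy : y.IsSymm) :
    Integrable (fun g => logPenalty ε r ⟪goeMat g, y⟫_ℝ) (goeEntries d) :=
  ((memLp_inner_goeMat hy (p := 2) (by simp)).integrable_sq.const_mul _).add
    (((memLp_inner_goeMat hy (p := 4) (by simp)).integrable_norm_pow (by simp)).congr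
      (.of_forall fun g => by simp [Even.pow_abs (by decide : Even 4)]) |>.const_mul _)

lemma integral_logPenalty_le (hd : 0 < d) {ε : ℝ} (hε : 0 ≤ ε) {y : Matrix (Fin d) (Fin d) ℝ}
    (hy : y.PosSemidef) (htr : y.trace ≤ 2) :
    ∫ g, logPenalty ε (√d) ⟪goeMat g, y⟫_ℝ ∂goeEntries d ≤
      ε ^ 2 / d * ‖center y‖ ^ 2 + 800 * (ε ^ 3 / (d * √d)) := by
  have hd' : (0 : ℝ) < d := by positivity
  have hsymm := isSymm_of_posSemidef hy
  have hsqrt : √d * √d = (d : ℝ) := Real.mul_self_sqrt hd'.le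
  have hsqrt0 : 0 < √(d : ℝ) := Real.sqrt_pos.2 hd'
  have hq : ‖center y‖ ^ 2 ≤ 2 ^ 2 := by gcongr; exact norm_center_le_two hy htr
  have hint2 : Integrable (fun g => (ε ^ 2 / 2 + 4 * ε ^ 3 * (√d)⁻¹) * ⟪goeMat g, y⟫_ℝ ^ 2)
      (goeEntries d) := (memLp_inner_goeMat hsymm (p := 2) (by simp)).integrable_sq.const_mul _
  have hint4 : Integrable (fun g => 4 * ε ^ 3 * √d * ⟪goeMat g, y⟫_ℝ ^ 4) (goeEntries d) :=
    ((integrable_logPenalty ε (√d) hsymm).sub hint2).congr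
      (.of_forall fun g => by simp [logPenalty])
  simp only [logPenalty]
  rw [integral_add hint2 hint4, integral_const_mul, integral_const_mul,
    integral_inner_goeMat_sq hsymm, integral_inner_goeMat_pow_four hsymm]
  have hq0 : 0 ≤ ‖center y‖ ^ 2 := sq_nonneg _
  generalize ‖center y‖ ^ 2 = q at hq hq0 ⊢
  calc (ε ^ 2 / 2 + 4 * ε ^ 3 * (√d)⁻¹) * (2 / d * q) + 4 * ε ^ 3 * √d * (3 * (2 / d * q) ^ 2)
      = ε ^ 2 / d * q + (8 * q + 48 * q ^ 2) * (ε ^ 3 / (d * √d)) := by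
        generalize √(d : ℝ) = s at hsqrt hsqrt0 ⊢
        rw [← hsqrt]; field_simp; ring
    _ ≤ ε ^ 2 / d * q + 800 * (ε ^ 3 / (d * √d)) := by gcongr; nlinarith

lemma integrable_inner_goeMat {X : Matrix (Fin d) (Fin d) ℝ} (hX : X.IsSymm) :
    Integrable (fun g => ⟪goeMat g, X⟫_ℝ) (goeEntries d) :=
  (memLp_inner_goeMat hX (by simp)).integrable le_rfl

lemma le_setIntegral_typicalSet_shift {c : ℝ} {W : Matrix (Fin d) (Fin d) ℝ}
    (hW : W.IsSymm) {q : (Sym2 (Fin d) → ℝ) → ℝ} (hq : Integrable q (goeEntries d))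
    (hq0 : ∀ g, 0 ≤ q g) :
    (goeEntries d).real (typicalSet d) * c - ∫ g, q g ∂goeEntries d ≤
      ∫ g in typicalSet d, (c + ⟪goeMat g, W⟫_ℝ - q g) ∂goeEntries d := by
  have hWint := (integrable_inner_goeMat hW).restrict (s := typicalSet d)
  have hcint : Integrable (fun g => c + ⟪goeMat g, W⟫_ℝ)
    ((goeEntries d).restrict (typicalSet d)) := (integrable_const c).add hWint
  have hodd : ∫ g in typicalSet d, ⟪goeMat g, W⟫_ℝ ∂goeEntries d = 0 :=
    setIntegral_goeRegion_of_odd fun g => by rw [map_neg, inner_neg_left]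
  rw [integral_sub hcint hq.restrict, integral_add (integrable_const c) hWint, hodd, add_zero,
    setIntegral_const, smul_eq_mul]
  exact sub_le_sub_left (setIntegral_le_integral hq (.of_forall hq0)) _

lemma logPenalty_nonneg {ε r : ℝ} (hε : 0 ≤ ε) (hr : 0 ≤ r) (a : ℝ) : 0 ≤ logPenalty ε r a := by
  unfold logPenalty; positivity

/-- The constant term in the lower bound for the log-likelihood of the outcomes `y` after the
Gaussian measure is translated by `H`; the last summand is the cost of the translation. -/
noncomputable def shiftGain (ε : ℝ) (y : Fin n → Matrix (Fin d) (Fin d) ℝ)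
    (H : Matrix (Fin d) (Fin d) ℝ) : ℝ :=
  ∑ t, (ε * ⟪H, y t⟫_ℝ - ε ^ 2 * ⟪H, y t⟫_ℝ ^ 2) - d / 4 * ‖H‖ ^ 2

/-- The slope of the linear term in the lower bound that has the constant term `shiftGain`. -/
noncomputable def shiftSlope (ε : ℝ) (y : Fin n → Matrix (Fin d) (Fin d) ℝ)
    (H : Matrix (Fin d) (Fin d) ℝ) : Matrix (Fin d) (Fin d) ℝ :=
  ∑ t, (ε - ε ^ 2 * ⟪H, y t⟫_ℝ) • y t - (d / 2 : ℝ) • H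

lemma shiftSlope_isSymm {ε : ℝ} {y : Fin n → Matrix (Fin d) (Fin d) ℝ} (hy : ∀ t, (y t).IsSymm)
    {H : Matrix (Fin d) (Fin d) ℝ} (hH : H.IsSymm) : (shiftSlope ε y H).IsSymm := by
  refine IsSymm.sub ?_ (hH.smul _)
  rw [IsSymm, transpose_sum]
  exact Finset.sum_congr rfl fun t _ => (hy t).smul _

section Likelihood

variable {ε : ℝ} {y : Fin n → Matrix (Fin d) (Fin d) ℝ} {H : Matrix (Fin d) (Fin d) ℝ}

lemma exp_expansion_le_shifted_likelihood (hd : 0 < d) {r : ℝ} (hε : 0 ≤ ε) (hε' : ε ≤ 1 / 12)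
    (hr : 0 < r) (hy : ∀ t, (y t).PosSemidef) (hytr : ∀ t, (y t).trace ≤ 2) (hH : H.IsSymm)
    (htr : H.trace = 0) (hnorm : ‖H‖ ≤ 1 / 10) {g : Sym2 (Fin d) → ℝ} (hg : g ∈ typicalSet d) :
    Real.exp (shiftGain ε y H + ⟪goeMat g, shiftSlope ε y H⟫_ℝ -
        ∑ t, logPenalty ε r ⟪goeMat g, y t⟫_ℝ) ≤
      Real.exp (-(d / 2 * ⟪goeMat g, H⟫_ℝ) - d / 4 * ‖H‖ ^ 2) *
        ∏ t, (1 + ε * ⟪goeMat (g + symEntries H), y t⟫_ℝ) := by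
  have hsplit : shiftGain ε y H + ⟪goeMat g, shiftSlope ε y H⟫_ℝ -
        ∑ t, logPenalty ε r ⟪goeMat g, y t⟫_ℝ =
      (-(d / 2 * ⟪goeMat g, H⟫_ℝ) - d / 4 * ‖H‖ ^ 2) +
        ∑ t, ((ε * ⟪H, y t⟫_ℝ - ε ^ 2 * ⟪H, y t⟫_ℝ ^ 2) +
          (ε - ε ^ 2 * ⟪H, y t⟫_ℝ) * ⟪goeMat g, y t⟫_ℝ - logPenalty ε r ⟪goeMat g, y t⟫_ℝ) := by
    simp only [shiftGain, shiftSlope, inner_sub_right, inner_sum, real_inner_smul_right,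
      Finset.sum_sub_distrib, Finset.sum_add_distrib]
    ring
  rw [hsplit, Real.exp_add, Real.exp_sum]
  gcongr with t
  exact exp_sub_logPenalty_le_likelihood hd hε hε' hr (hy t) (hytr t) hH htr hnorm hg

lemma continuous_prod_one_add_inner (ε : ℝ) (y : Fin n → Matrix (Fin d) (Fin d) ℝ) :
    Continuous fun M : Matrix (Fin d) (Fin d) ℝ => ∏ t, (1 + ε * ⟪M, y t⟫_ℝ) :=
  continuous_finsetProd _ fun _ _ => continuous_const.add (continuous_const.mul
    (continuous_id.inner continuous_const))

lemma measurable_likelihood (ε : ℝ) (y : Fin n → Matrix (Fin d) (Fin d) ℝ) :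
    Measurable fun g => ENNReal.ofReal (∏ t, (1 + ε * ⟪goeMat g, y t⟫_ℝ)) :=
  ((continuous_prod_one_add_inner ε y).comp
    goeMat.continuous_of_finiteDimensional).measurable.ennreal_ofReal

lemma le_lintegral_likelihood_of_shift (hd : 0 < d) (hε : 0 ≤ ε) (hε' : ε ≤ 1 / 12)
    (hy : ∀ t, (y t).PosSemidef) (hytr : ∀ t, (y t).trace ≤ 2) (hH : H.IsSymm)
    (htr : H.trace = 0) (hnorm : ‖H‖ ≤ 1 / 10) {v : ℝ}
    (hv : v = (goeEntries d).real (typicalSet d)) (hv0 : 0 < v) :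
    ENNReal.ofReal (v * Real.exp (shiftGain ε y H -
        v⁻¹ * ∑ t, (ε ^ 2 / d * ‖center (y t)‖ ^ 2 + 800 * (ε ^ 3 / (d * √d))))) ≤
      ∫⁻ g in truncatedEntries d, ENNReal.ofReal (∏ t, (1 + ε * ⟪goeMat g, y t⟫_ℝ))
        ∂goeEntries d := by
  have hsqrt : 0 < √(d : ℝ) := by positivity
  have hsymm (t : Fin n) : (y t).IsSymm := isSymm_of_posSemidef (hy t)
  have hWsymm : (shiftSlope ε y H).IsSymm := shiftSlope_isSymm hsymm hH
  set φ : (Sym2 (Fin d) → ℝ) → ℝ := fun g => shiftGain ε y H + ⟪goeMat g, shiftSlope ε y H⟫_ℝ -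
    ∑ t, logPenalty ε (√d) ⟪goeMat g, y t⟫_ℝ
  have hpenalty : Integrable (fun g => ∑ t, logPenalty ε (√d) ⟪goeMat g, y t⟫_ℝ) (goeEntries d) :=
    integrable_finsetSum _ fun t _ => integrable_logPenalty ε _ (hsymm t)
  have hφint : Integrable φ (goeEntries d) :=
    ((integrable_const _).add (integrable_inner_goeMat hWsymm)).sub hpenalty
  have hpenalty_le : ∫ g, ∑ t, logPenalty ε (√d) ⟪goeMat g, y t⟫_ℝ ∂goeEntries d ≤
      ∑ t, (ε ^ 2 / d * ‖center (y t)‖ ^ 2 + 800 * (ε ^ 3 / (d * √d))) := by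
    rw [integral_finsetSum _ fun t _ => integrable_logPenalty ε _ (hsymm t)]
    exact Finset.sum_le_sum fun t _ => integral_logPenalty_le hd hε (hy t) (hytr t)
  have hmean : shiftGain ε y H -
        v⁻¹ * ∑ t, (ε ^ 2 / d * ‖center (y t)‖ ^ 2 + 800 * (ε ^ 3 / (d * √d))) ≤
      v⁻¹ * ∫ g in typicalSet d, φ g ∂goeEntries d := by
    have hshift := le_setIntegral_typicalSet_shift (c := shiftGain ε y H) hWsymm hpenalty
      fun g => Finset.sum_nonneg fun t _ => logPenalty_nonneg hε hsqrt.le _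
    rw [← hv] at hshift
    rw [le_inv_mul_iff₀ hv0, mul_sub, mul_inv_cancel_left₀ hv0.ne']
    linarith
  calc ENNReal.ofReal (v * Real.exp (shiftGain ε y H -
        v⁻¹ * ∑ t, (ε ^ 2 / d * ‖center (y t)‖ ^ 2 + 800 * (ε ^ 3 / (d * √d)))))
      ≤ ENNReal.ofReal (v * Real.exp (v⁻¹ * ∫ g in typicalSet d, φ g ∂goeEntries d)) := by gcongr
    _ ≤ ∫⁻ g in typicalSet d, ENNReal.ofReal (Real.exp (φ g)) ∂goeEntries d := by
        subst hv; exact ofReal_mul_exp_le_setLIntegral hv0 hφint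
    _ ≤ _ := setLIntegral_mono' (measurableSet_goeRegion _ _) fun g hg => by
        refine (ENNReal.ofReal_le_ofReal (exp_expansion_le_shifted_likelihood hd hε hε' hsqrt hy
          hytr hH htr hnorm hg)).trans_eq ?_
        rw [ENNReal.ofReal_mul (Real.exp_pos _).le]
    _ ≤ _ := setLIntegral_shift_le hd hH htr hnorm (measurable_likelihood ε y)

/-- The sum of the centered outcomes along a path, the direction of the translation. -/
noncomputable def centeredSum (y : Fin n → Matrix (Fin d) (Fin d) ℝ) : Matrix (Fin d) (Fin d) ℝ :=
  ∑ t, center (y t)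

lemma centeredSum_isSymm (hy : ∀ t, (y t).IsSymm) : (centeredSum y).IsSymm := by
  rw [centeredSum, IsSymm, transpose_sum]
  exact Finset.sum_congr rfl fun t _ => center_isSymm (hy t)

lemma trace_centeredSum (y : Fin n → Matrix (Fin d) (Fin d) ℝ) : (centeredSum y).trace = 0 := by
  rw [centeredSum, trace_sum]
  exact Finset.sum_eq_zero fun t _ => trace_center _

lemma shiftGain_centeredSum (hd : 0 < d) (ε : ℝ) (y : Fin n → Matrix (Fin d) (Fin d) ℝ) :
    shiftGain ε y ((2 * ε / d) • centeredSum y) = ε ^ 2 / d * ‖centeredSum y‖ ^ 2 -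
      ε ^ 2 * (2 * ε / d) ^ 2 * ∑ t, ⟪centeredSum y, center (y t)⟫_ℝ ^ 2 := by
  have hd' : (d : ℝ) ≠ 0 := by positivity
  have hinner (t : Fin n) : ⟪(2 * ε / d) • centeredSum y, y t⟫_ℝ =
      2 * ε / d * ⟪centeredSum y, center (y t)⟫_ℝ := by
    rw [real_inner_smul_left, ← inner_center_left, center_of_trace_eq_zero (trace_centeredSum y)]
  have hsum : ∑ t, ⟪centeredSum y, center (y t)⟫_ℝ = ‖centeredSum y‖ ^ 2 := by
    rw [← inner_sum, ← real_inner_self_eq_norm_sq]; rfl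
  simp only [shiftGain, hinner, norm_smul, Real.norm_eq_abs, mul_pow, sq_abs,
    Finset.sum_sub_distrib, ← Finset.mul_sum, hsum]
  field_simp
  ring

lemma le_lintegral_likelihood (hd : 0 < d) (hε : 0 ≤ ε) (hε' : ε ≤ 1 / 12)
    (hy : ∀ t, (y t).PosSemidef) (hytr : ∀ t, (y t).trace ≤ 2)
    (hS : (2 * ε / d) ^ 2 * ‖centeredSum y‖ ^ 2 ≤ 1 / 100) {v : ℝ}
    (hv : v = (goeEntries d).real (typicalSet d)) (hv0 : 0 < v) :
    ENNReal.ofReal (v * Real.exp (ε ^ 2 / d * (‖centeredSum y‖ ^ 2 -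
          v⁻¹ * ∑ t, ‖center (y t)‖ ^ 2) -
        ε ^ 2 * (2 * ε / d) ^ 2 * ∑ t, ⟪centeredSum y, center (y t)⟫_ℝ ^ 2 -
        800 * (n * ε ^ 3 / (d * √d)) * v⁻¹)) ≤
      ∫⁻ g in truncatedEntries d, ENNReal.ofReal (∏ t, (1 + ε * ⟪goeMat g, y t⟫_ℝ))
        ∂goeEntries d := by
  have hnorm : ‖(2 * ε / d) • centeredSum y‖ ≤ 1 / 10 := by
    refine abs_le_of_sq_le_sq' ?_ (by norm_num) |>.2
    rw [norm_smul, mul_pow, Real.norm_eq_abs, sq_abs]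
    linarith
  have hshift := le_lintegral_likelihood_of_shift hd hε hε' hy hytr
    ((centeredSum_isSymm fun t => isSymm_of_posSemidef (hy t)).smul _)
    (by rw [trace_smul, trace_centeredSum, smul_zero]) hnorm hv hv0
  convert hshift using 4
  rw [shiftGain_centeredSum hd, Finset.sum_add_distrib, ← Finset.mul_sum, Finset.sum_const,
    Finset.card_univ, Fintype.card_fin, nsmul_eq_mul]
  ring

end Likelihood

end LikelihoodRatio

section Increments

open scoped InnerProductSpace

variable {Z E : Type*} [Fintype Z] [NormedAddCommGroup E] [InnerProductSpace ℝ E]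

/-- `p` is a probability distribution on `Z` under which the random vector `Y` is centered, bounded
by `r`, and has covariance at most `κ`. -/
structure IsBoundedIncrement (p : Z → ℝ) (Y : Z → E) (κ r : ℝ) : Prop where
  nonneg : ∀ z, 0 ≤ p z
  sum_eq_one : ∑ z, p z = 1
  mean_eq_zero : ∑ z, p z • Y z = 0
  norm_le : ∀ z, ‖Y z‖ ≤ r
  covariance_le : ∀ v, ∑ z, p z * ⟪v, Y z⟫_ℝ ^ 2 ≤ κ * ‖v‖ ^ 2

namespace IsBoundedIncrement

variable {p : Z → ℝ} {Y : Z → E} {κ r : ℝ}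

lemma sum_mul_const (h : IsBoundedIncrement p Y κ r) (c : ℝ) : ∑ z, p z * c = c := by
  rw [← Finset.sum_mul, h.sum_eq_one, one_mul]

lemma sum_mul_inner_eq_zero (h : IsBoundedIncrement p Y κ r) (v : E) :
    ∑ z, p z * ⟪v, Y z⟫_ℝ = 0 := by
  simp only [← real_inner_smul_right, ← inner_sum, h.mean_eq_zero, inner_zero_right]

lemma sum_norm_add_sq_le (h : IsBoundedIncrement p Y κ r) (S : E) :
    ∑ z, p z * ‖S + Y z‖ ^ 2 ≤ ‖S‖ ^ 2 + r ^ 2 := by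
  calc ∑ z, p z * ‖S + Y z‖ ^ 2
      = ∑ z, p z * (‖S‖ ^ 2 + ‖Y z‖ ^ 2) + 2 * ∑ z, p z * ⟪S, Y z⟫_ℝ := by
        rw [Finset.mul_sum, ← Finset.sum_add_distrib]
        exact Finset.sum_congr rfl fun z _ => by rw [norm_add_sq_real]; ring
    _ ≤ ∑ z, p z * (‖S‖ ^ 2 + r ^ 2) + 2 * ∑ z, p z * ⟪S, Y z⟫_ℝ := by
        gcongr with z
        exacts [h.nonneg z, h.norm_le z]
    _ = ‖S‖ ^ 2 + r ^ 2 := by rw [h.sum_mul_inner_eq_zero, h.sum_mul_const]; ring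

lemma sum_norm_add_sq_sub_sq_le (h : IsBoundedIncrement p Y κ r) (S : E) (c : ℝ) :
    ∑ z, p z * (‖S + Y z‖ ^ 2 - (c + ‖Y z‖ ^ 2)) ^ 2 ≤
      (‖S‖ ^ 2 - c) ^ 2 + 4 * κ * ‖S‖ ^ 2 := by
  calc ∑ z, p z * (‖S + Y z‖ ^ 2 - (c + ‖Y z‖ ^ 2)) ^ 2
      = ∑ z, p z * (‖S‖ ^ 2 - c) ^ 2 + 4 * (‖S‖ ^ 2 - c) * ∑ z, p z * ⟪S, Y z⟫_ℝ +
          4 * ∑ z, p z * ⟪S, Y z⟫_ℝ ^ 2 := by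
        rw [Finset.mul_sum, Finset.mul_sum, ← Finset.sum_add_distrib, ← Finset.sum_add_distrib]
        exact Finset.sum_congr rfl fun z _ => by rw [norm_add_sq_real]; ring
    _ ≤ (‖S‖ ^ 2 - c) ^ 2 + 4 * κ * ‖S‖ ^ 2 := by
        rw [h.sum_mul_inner_eq_zero, h.sum_mul_const]
        linarith [h.covariance_le S]

lemma sum_inner_add_sq_le (h : IsBoundedIncrement p Y κ r) (S v : E) :
    ∑ z, p z * ⟪S + Y z, v⟫_ℝ ^ 2 ≤ ⟪S, v⟫_ℝ ^ 2 + κ * ‖v‖ ^ 2 := by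
  calc ∑ z, p z * ⟪S + Y z, v⟫_ℝ ^ 2
      = ∑ z, p z * ⟪S, v⟫_ℝ ^ 2 + 2 * ⟪S, v⟫_ℝ * ∑ z, p z * ⟪v, Y z⟫_ℝ +
          ∑ z, p z * ⟪v, Y z⟫_ℝ ^ 2 := by
        rw [Finset.mul_sum, ← Finset.sum_add_distrib, ← Finset.sum_add_distrib]
        exact Finset.sum_congr rfl fun z _ => by
          rw [inner_add_left, real_inner_comm v (Y z)]; ring
    _ ≤ ⟪S, v⟫_ℝ ^ 2 + κ * ‖v‖ ^ 2 := by
        rw [h.sum_mul_inner_eq_zero, h.sum_mul_const]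
        linarith [h.covariance_le v]

lemma sum_inner_add_self_sq_le (h : IsBoundedIncrement p Y κ r) (S : E) :
    ∑ z, p z * ⟪S + Y z, Y z⟫_ℝ ^ 2 ≤ 2 * κ * ‖S‖ ^ 2 + 2 * r ^ 4 := by
  have hsq (z : Z) : ⟪S + Y z, Y z⟫_ℝ ^ 2 ≤ 2 * ⟪S, Y z⟫_ℝ ^ 2 + 2 * r ^ 4 := by
    have hpow : ‖Y z‖ ^ 4 ≤ r ^ 4 := by gcongr; exact h.norm_le z
    rw [inner_add_left, real_inner_self_eq_norm_sq]
    linarith [add_sq_le (a := ⟪S, Y z⟫_ℝ) (b := ‖Y z‖ ^ 2)]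
  calc ∑ z, p z * ⟪S + Y z, Y z⟫_ℝ ^ 2
      ≤ ∑ z, p z * (2 * ⟪S, Y z⟫_ℝ ^ 2 + 2 * r ^ 4) := by
        gcongr with z
        exacts [h.nonneg z, hsq z]
    _ = 2 * ∑ z, p z * ⟪S, Y z⟫_ℝ ^ 2 + 2 * r ^ 4 := by
        simp only [mul_add, Finset.sum_add_distrib, h.sum_mul_const, mul_left_comm _ (2 : ℝ),
          ← Finset.mul_sum]
    _ ≤ 2 * κ * ‖S‖ ^ 2 + 2 * r ^ 4 := by linarith [h.covariance_le S]

end IsBoundedIncrement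

end Increments

section Tree

open scoped InnerProductSpace

variable {n : ℕ} {Z : Type*}

/-- The outcomes observed before step `t`. -/
def pathHistory (x : Fin n → Z) (t : Fin n) : Fin t → Z := fun j => x (Fin.castLE t.isLt.le j)

/-- A quantity attached to the edges of a tree, at step `t` of a path. -/
def pathValue {E : Type*} (Y : (t : Fin n) → (Fin t → Z) → Z → E) (x : Fin n → Z) (t : Fin n) : E :=
  Y t (pathHistory x t) (x t)

/-- The probability of a path, given the conditional probabilities of its steps. -/
def pathWeight (q : (t : Fin n) → (Fin t → Z) → Z → ℝ) (x : Fin n → Z) : ℝ :=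
  ∏ t, pathValue q x t

/-- The restriction to all steps but the last. -/
def treeInit {E : Type*} (Y : (t : Fin (n + 1)) → (Fin t → Z) → Z → E) :
    (t : Fin n) → (Fin t → Z) → Z → E := fun t h z => Y t.castSucc h z

lemma pathHistory_snoc_castSucc (x : Fin n → Z) (z : Z) (t : Fin n) :
    pathHistory (Fin.snoc x z : Fin (n + 1) → Z) t.castSucc = pathHistory x t := by
  funext j
  exact Fin.snoc_castSucc (α := fun _ => Z) z x (Fin.castLE t.isLt.le j)

lemma pathHistory_snoc_last (x : Fin n → Z) (z : Z) :
    pathHistory (Fin.snoc x z : Fin (n + 1) → Z) (Fin.last n) = x := by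
  funext j
  exact Fin.snoc_castSucc (α := fun _ => Z) z x j

lemma pathValue_snoc_castSucc {E : Type*} (Y : (t : Fin (n + 1)) → (Fin t → Z) → Z → E)
    (x : Fin n → Z) (z : Z) (t : Fin n) :
    pathValue Y (Fin.snoc x z : Fin (n + 1) → Z) t.castSucc = pathValue (treeInit Y) x t := by
  rw [pathValue, pathHistory_snoc_castSucc, Fin.snoc_castSucc]; rfl

lemma pathValue_snoc_last {E : Type*} (Y : (t : Fin (n + 1)) → (Fin t → Z) → Z → E)
    (x : Fin n → Z) (z : Z) :
    pathValue Y (Fin.snoc x z : Fin (n + 1) → Z) (Fin.last n) = Y (Fin.last n) x z := by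
  rw [pathValue, pathHistory_snoc_last, Fin.snoc_last]

lemma pathWeight_snoc (q : (t : Fin (n + 1)) → (Fin t → Z) → Z → ℝ) (x : Fin n → Z) (z : Z) :
    pathWeight q (Fin.snoc x z : Fin (n + 1) → Z) =
      pathWeight (treeInit q) x * q (Fin.last n) x z := by
  simp only [pathWeight, Fin.prod_univ_castSucc, pathValue_snoc_last, pathValue_snoc_castSucc]

variable [Fintype Z]

lemma sum_pathWeight_succ (q : (t : Fin (n + 1)) → (Fin t → Z) → Z → ℝ)
    (f : (Fin (n + 1) → Z) → ℝ) :
    ∑ x, pathWeight q x * f x =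
      ∑ x, pathWeight (treeInit q) x * ∑ z, q (Fin.last n) x z * f (Fin.snoc x z) := by
  rw [← (Fin.snocEquiv fun _ => Z).sum_comp, Fintype.sum_prod_type, Finset.sum_comm]
  refine Finset.sum_congr rfl fun x _ => ?_
  rw [Finset.mul_sum]
  exact Finset.sum_congr rfl fun z _ =>
    (congrArg (· * f (Fin.snoc x z)) (pathWeight_snoc q x z)).trans (mul_assoc _ _ _)

lemma sum_pathWeight_eq_one (q : (t : Fin n) → (Fin t → Z) → Z → ℝ)
    (hq : ∀ t h, ∑ z, q t h z = 1) : ∑ x, pathWeight q x = 1 := by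
  induction n with
  | zero => simp [pathWeight]
  | succ n ih =>
    have hsucc := sum_pathWeight_succ q fun _ => 1
    simp only [mul_one, hq] at hsucc
    rw [hsucc, ih (treeInit q) fun t h => hq t.castSucc h]

variable {E : Type*} [NormedAddCommGroup E] [InnerProductSpace ℝ E]

/-- The vector at step `t` of a path of a tree is a martingale difference: given the history, it is
a bounded increment under the conditional distribution `q` of the next step. -/
def IsTreeMartingale (q : (t : Fin n) → (Fin t → Z) → Z → ℝ)
    (Y : (t : Fin n) → (Fin t → Z) → Z → E) (κ r : ℝ) : Prop :=
  ∀ t h, IsBoundedIncrement (q t h) (Y t h) κ r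

namespace IsTreeMartingale

variable {κ r : ℝ}

lemma init {q : (t : Fin (n + 1)) → (Fin t → Z) → Z → ℝ}
    {Y : (t : Fin (n + 1)) → (Fin t → Z) → Z → E} (h : IsTreeMartingale q Y κ r) :
    IsTreeMartingale (treeInit q) (treeInit Y) κ r := fun t => h t.castSucc

variable {q : (t : Fin n) → (Fin t → Z) → Z → ℝ} {Y : (t : Fin n) → (Fin t → Z) → Z → E}

lemma pathWeight_nonneg (h : IsTreeMartingale q Y κ r) (x : Fin n → Z) : 0 ≤ pathWeight q x :=
  Finset.prod_nonneg fun _ _ => (h _ _).nonneg _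

lemma sum_pathWeight (h : IsTreeMartingale q Y κ r) : ∑ x, pathWeight q x = 1 :=
  sum_pathWeight_eq_one q fun t p => (h t p).sum_eq_one

lemma sum_pathWeight_mul_le_of_step {q : (t : Fin (n + 1)) → (Fin t → Z) → Z → ℝ}
    {Y : (t : Fin (n + 1)) → (Fin t → Z) → Z → E} (h : IsTreeMartingale q Y κ r)
    {f : (Fin (n + 1) → Z) → ℝ} {g : (Fin n → Z) → ℝ}
    (hstep : ∀ x, ∑ z, q (Fin.last n) x z * f (Fin.snoc x z) ≤ g x) :
    ∑ x, pathWeight q x * f x ≤ ∑ x, pathWeight (treeInit q) x * g x := by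
  rw [sum_pathWeight_succ]
  exact Finset.sum_le_sum fun x _ =>
    mul_le_mul_of_nonneg_left (hstep x) (h.init.pathWeight_nonneg x)

lemma mean_norm_sum_sq_le (h : IsTreeMartingale q Y κ r) :
    ∑ x, pathWeight q x * ‖∑ t, pathValue Y x t‖ ^ 2 ≤ r ^ 2 * n := by
  induction n with
  | zero => simp
  | succ n ih =>
    refine (h.sum_pathWeight_mul_le_of_step (g := fun x =>
      ‖∑ t, pathValue (treeInit Y) x t‖ ^ 2 + r ^ 2) fun x => ?_).trans ?_
    · simp only [Fin.sum_univ_castSucc, pathValue_snoc_castSucc, pathValue_snoc_last]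
      exact (h (Fin.last n) x).sum_norm_add_sq_le _
    · simp only [mul_add, Finset.sum_add_distrib, ← Finset.sum_mul, h.init.sum_pathWeight]
      push_cast
      linarith [ih h.init]

lemma mean_sq_norm_sum_sq_sub_le (h : IsTreeMartingale q Y κ r) (hκ : 0 ≤ κ) :
    ∑ x, pathWeight q x * (‖∑ t, pathValue Y x t‖ ^ 2 - ∑ t, ‖pathValue Y x t‖ ^ 2) ^ 2 ≤
      2 * κ * r ^ 2 * n ^ 2 := by
  induction n with
  | zero => simp
  | succ n ih =>
    refine (h.sum_pathWeight_mul_le_of_step (g := fun x =>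
      (‖∑ t, pathValue (treeInit Y) x t‖ ^ 2 - ∑ t, ‖pathValue (treeInit Y) x t‖ ^ 2) ^ 2 +
        4 * κ * ‖∑ t, pathValue (treeInit Y) x t‖ ^ 2) fun x => ?_).trans ?_
    · simp only [Fin.sum_univ_castSucc, pathValue_snoc_castSucc, pathValue_snoc_last]
      exact (h (Fin.last n) x).sum_norm_add_sq_sub_sq_le _ _
    · simp only [mul_add, Finset.sum_add_distrib, mul_left_comm _ (4 * κ), ← Finset.mul_sum]
      have hnorm := mul_le_mul_of_nonneg_left h.init.mean_norm_sum_sq_le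
        (by positivity : 0 ≤ 4 * κ)
      have hκr : 0 ≤ κ * r ^ 2 := by positivity
      push_cast
      linarith [ih h.init]

lemma sum_step_inner_sq_le {q : (t : Fin (n + 1)) → (Fin t → Z) → Z → ℝ}
    {Y : (t : Fin (n + 1)) → (Fin t → Z) → Z → E} (h : IsTreeMartingale q Y κ r) (hκ : 0 ≤ κ)
    (x : Fin n → Z) :
    ∑ z, q (Fin.last n) x z * (∑ t, ⟪∑ s, pathValue (treeInit Y) x s + Y (Fin.last n) x z,
        pathValue (treeInit Y) x t⟫_ℝ ^ 2 +
        ⟪∑ s, pathValue (treeInit Y) x s + Y (Fin.last n) x z, Y (Fin.last n) x z⟫_ℝ ^ 2) ≤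
      ∑ t, ⟪∑ s, pathValue (treeInit Y) x s, pathValue (treeInit Y) x t⟫_ℝ ^ 2 +
        2 * κ * ‖∑ t, pathValue (treeInit Y) x t‖ ^ 2 + (κ * r ^ 2 * n + 2 * r ^ 4) := by
  set S := ∑ s, pathValue (treeInit Y) x s
  have hold (t : Fin n) : ∑ z, q (Fin.last n) x z *
      ⟪S + Y (Fin.last n) x z, pathValue (treeInit Y) x t⟫_ℝ ^ 2 ≤
        ⟪S, pathValue (treeInit Y) x t⟫_ℝ ^ 2 + κ * r ^ 2 := by
    refine ((h (Fin.last n) x).sum_inner_add_sq_le S _).trans ?_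
    gcongr
    exact (h.init t _).norm_le _
  have hold_sum := Finset.sum_le_sum fun t (_ : t ∈ Finset.univ) => hold t
  rw [Finset.sum_add_distrib, Finset.sum_const, Finset.card_univ, Fintype.card_fin, nsmul_eq_mul,
    Finset.sum_comm] at hold_sum
  simp only [mul_add, Finset.sum_add_distrib, Finset.mul_sum] at hold_sum ⊢
  linarith [(h (Fin.last n) x).sum_inner_add_self_sq_le S]

lemma mean_sum_inner_sq_le (h : IsTreeMartingale q Y κ r) (hκ : 0 ≤ κ) :
    ∑ x, pathWeight q x * ∑ t, ⟪∑ s, pathValue Y x s, pathValue Y x t⟫_ℝ ^ 2 ≤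
      3 / 2 * κ * r ^ 2 * n ^ 2 + 2 * r ^ 4 * n := by
  induction n with
  | zero => simp
  | succ n ih =>
    refine (h.sum_pathWeight_mul_le_of_step (g := fun x =>
      ∑ t, ⟪∑ s, pathValue (treeInit Y) x s, pathValue (treeInit Y) x t⟫_ℝ ^ 2 +
        2 * κ * ‖∑ t, pathValue (treeInit Y) x t‖ ^ 2 + (κ * r ^ 2 * n + 2 * r ^ 4))
      fun x => ?_).trans ?_
    · simp only [Fin.sum_univ_castSucc, pathValue_snoc_castSucc, pathValue_snoc_last]
      exact h.sum_step_inner_sq_le hκ x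
    · simp only [mul_add (pathWeight _ _), Finset.sum_add_distrib, mul_left_comm _ (2 * κ),
        ← Finset.sum_mul, ← Finset.mul_sum, h.init.sum_pathWeight]
      have hnorm := mul_le_mul_of_nonneg_left h.init.mean_norm_sum_sq_le
        (by positivity : 0 ≤ 2 * κ)
      have hκr : 0 ≤ κ * r ^ 2 := by positivity
      push_cast
      linarith [ih h.init]

end IsTreeMartingale

end Tree

section Povm

open Matrix
open scoped InnerProductSpace Matrix.Norms.Frobenius

variable {d n : ℕ} {Z : Type} [Fintype Z] {a : Fin d → ℝ}

lemma inner_diagonal (a : Fin d → ℝ) (B : Matrix (Fin d) (Fin d) ℝ) :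
    ⟪diagonal a, B⟫_ℝ = ∑ i, a i * B i i := by
  simp [frobenius_inner_eq_sum, diagonal_apply]

lemma IsReference.half_le (ha : IsReference a) (j : Fin d) : 1 / 2 ≤ a j := by
  have hd : (0 : ℝ) < d := by exact_mod_cast Fin.pos j
  have hsum : ∑ i, a i ≤ ∑ _i : Fin d, 2 * a j :=
    Finset.sum_le_sum fun i _ => ha.comparable i j
  rw [ha.trace_eq, Finset.sum_const, Finset.card_univ, Fintype.card_fin, nsmul_eq_mul] at hsum
  linarith [le_of_mul_le_mul_left ((mul_one (d : ℝ)).trans_le hsum) hd]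

section Reference

variable {B : Matrix (Fin d) (Fin d) ℝ}

lemma IsReference.trace_le (ha : IsReference a) (hB : B.PosSemidef) :
    B.trace ≤ 2 * ⟪diagonal a, B⟫_ℝ := by
  rw [inner_diagonal, Matrix.trace, Finset.mul_sum]
  refine Finset.sum_le_sum fun i _ => ?_
  rw [Matrix.diag_apply]
  nlinarith [ha.half_le i, hB.diag_nonneg (i := i)]

lemma IsReference.inner_diagonal_nonneg (ha : IsReference a) (hB : B.PosSemidef) :
    0 ≤ ⟪diagonal a, B⟫_ℝ := by
  linarith [ha.trace_le hB, hB.trace_nonneg]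

lemma IsReference.eq_zero_of_inner_diagonal_eq_zero (ha : IsReference a) (hB : B.PosSemidef)
    (h : ⟪diagonal a, B⟫_ℝ = 0) : B = 0 :=
  hB.trace_eq_zero_iff.1 (le_antisymm (by linarith [ha.trace_le hB]) hB.trace_nonneg)

end Reference

namespace POVM

variable (P : POVM d Z)

/-- The entrywise real part of a POVM element; only this part of the element is seen by the real
states of the problem. -/
def reElem (z : Z) : Matrix (Fin d) (Fin d) ℝ := rePart (P.elem z)

lemma reElem_posSemidef (z : Z) : (P.reElem z).PosSemidef := rePart_posSemidef (P.posSemidef z)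

lemma sum_reElem : ∑ z, P.reElem z = 1 := by
  ext i j
  have hre := congrArg Complex.re (congrFun (congrFun P.sum_elem i) j)
  rw [Matrix.sum_apply, Complex.re_sum] at hre
  rw [Matrix.sum_apply]
  refine hre.trans ?_
  by_cases hij : i = j <;> simp [Matrix.one_apply, hij]

lemma prob_map_ofReal (R : Matrix (Fin d) (Fin d) ℝ) (z : Z) :
    P.prob (R.map fun r : ℝ => (r : ℂ)) z = ⟪R, P.reElem z⟫_ℝ :=
  re_trace_map_ofReal_mul (P.posSemidef z) R

lemma sum_prob_map_ofReal (R : Matrix (Fin d) (Fin d) ℝ) :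
    ∑ z, P.prob (R.map fun r : ℝ => (r : ℂ)) z = R.trace := by
  simp only [prob_map_ofReal]
  rw [← inner_sum, P.sum_reElem, frobenius_inner_one_right]

/-- A POVM element normalized by its probability under the null hypothesis, up to the factor `d`:
the likelihood ratio of its outcome is an affine function of the perturbation with this slope. It is
`0` when the outcome is impossible. -/
noncomputable def normalized (a : Fin d → ℝ) (z : Z) : Matrix (Fin d) (Fin d) ℝ :=
  (⟪diagonal a, P.reElem z⟫_ℝ)⁻¹ • P.reElem z

lemma prob_nullState (a : Fin d → ℝ) (z : Z) :
    P.prob (nullState a) z = 1 / d * ⟪diagonal a, P.reElem z⟫_ℝ := by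
  rw [nullState, P.prob_map_ofReal, real_inner_smul_left]

lemma prob_nullState_nonneg (ha : IsReference a) (z : Z) : 0 ≤ P.prob (nullState a) z := by
  rw [P.prob_nullState]
  exact mul_nonneg (by positivity) (ha.inner_diagonal_nonneg (P.reElem_posSemidef z))

lemma prob_nullState_smul_normalized (ha : IsReference a) (z : Z) :
    P.prob (nullState a) z • P.normalized a z = (1 / (d : ℝ)) • P.reElem z := by
  rw [P.prob_nullState, normalized, smul_smul]
  by_cases h : ⟪diagonal a, P.reElem z⟫_ℝ = 0
  · rw [ha.eq_zero_of_inner_diagonal_eq_zero (P.reElem_posSemidef z) h, smul_zero, smul_zero]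
  · rw [mul_assoc, mul_inv_cancel₀ h, mul_one]

lemma prob_perturbedState (ha : IsReference a) (ε : ℝ) (M : Matrix (Fin d) (Fin d) ℝ) (z : Z) :
    P.prob (perturbedState a ε M) z =
      P.prob (nullState a) z * (1 + ε * ⟪M, P.normalized a z⟫_ℝ) := by
  have hinner : P.prob (nullState a) z * ⟪M, P.normalized a z⟫_ℝ = 1 / d * ⟪M, P.reElem z⟫_ℝ := by
    rw [← real_inner_smul_right, P.prob_nullState_smul_normalized ha, real_inner_smul_right]
  rw [perturbedState, P.prob_map_ofReal, real_inner_smul_left, inner_add_left,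
    real_inner_smul_left, mul_add (P.prob (nullState a) z), mul_left_comm _ ε, hinner,
    P.prob_nullState]
  ring

lemma normalized_posSemidef (ha : IsReference a) (z : Z) : (P.normalized a z).PosSemidef :=
  (P.reElem_posSemidef z).smul (inv_nonneg.2 (ha.inner_diagonal_nonneg (P.reElem_posSemidef z)))

lemma trace_normalized_le (ha : IsReference a) (z : Z) : (P.normalized a z).trace ≤ 2 := by
  rw [normalized, Matrix.trace_smul, smul_eq_mul, inv_mul_eq_div]
  exact div_le_of_le_mul₀ (ha.inner_diagonal_nonneg (P.reElem_posSemidef z)) (by norm_num)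
    (ha.trace_le (P.reElem_posSemidef z))

lemma sum_prob_perturbedState (hd : 0 < d) (ha : IsReference a) (ε : ℝ)
    {M : Matrix (Fin d) (Fin d) ℝ} (hM : M.trace = 0) :
    ∑ z, P.prob (perturbedState a ε M) z = 1 := by
  have hd' : (d : ℝ) ≠ 0 := by positivity
  rw [perturbedState, P.sum_prob_map_ofReal, Matrix.trace_smul, Matrix.trace_add,
    Matrix.trace_smul, hM, Matrix.trace_diagonal, ha.trace_eq, smul_zero, add_zero, smul_eq_mul,
    one_div_mul_cancel hd']

lemma sum_prob_nullState (hd : 0 < d) (ha : IsReference a) :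
    ∑ z, P.prob (nullState a) z = 1 := by
  simpa [perturbedState, nullState] using
    P.sum_prob_perturbedState hd ha 0 (M := 0) (Matrix.trace_zero _ _)

lemma mean_normalized (ha : IsReference a) :
    ∑ z, P.prob (nullState a) z • P.normalized a z = (1 / (d : ℝ)) • 1 := by
  simp only [P.prob_nullState_smul_normalized ha]
  rw [← Finset.smul_sum, P.sum_reElem]

lemma mean_inner_normalized (ha : IsReference a) (V : Matrix (Fin d) (Fin d) ℝ) :
    ∑ z, P.prob (nullState a) z * ⟪V, P.normalized a z⟫_ℝ = V.trace / d := by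
  simp only [← real_inner_smul_right]
  rw [← inner_sum, P.mean_normalized ha, real_inner_smul_right, frobenius_inner_one_right,
    one_div_mul_eq_div]

lemma inner_normalized_sq_le (ha : IsReference a) (V : Matrix (Fin d) (Fin d) ℝ) (z : Z) :
    ⟪V, P.normalized a z⟫_ℝ ^ 2 ≤ 2 * ⟪Vᵀ * V, P.normalized a z⟫_ℝ := by
  have hB := P.normalized_posSemidef ha z
  have hnonneg : 0 ≤ ⟪Vᵀ * V, P.normalized a z⟫_ℝ := by
    obtain ⟨C, hC⟩ := exists_eq_transpose_mul_self hB
    rw [hC, real_inner_comm, inner_transpose_mul_self]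
    exact Finset.sum_nonneg fun k _ => by
      simpa using (hC ▸ hB).dotProduct_mulVec_nonneg (V k)
  calc ⟪V, P.normalized a z⟫_ℝ ^ 2 ≤ ⟪Vᵀ * V, P.normalized a z⟫_ℝ * (P.normalized a z).trace :=
        inner_sq_le_inner_mul_trace hB V
    _ ≤ ⟪Vᵀ * V, P.normalized a z⟫_ℝ * 2 := by gcongr; exact P.trace_normalized_le ha z
    _ = 2 * ⟪Vᵀ * V, P.normalized a z⟫_ℝ := mul_comm _ _

lemma covariance_normalized_le (ha : IsReference a) (V : Matrix (Fin d) (Fin d) ℝ) :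
    ∑ z, P.prob (nullState a) z * ⟪V, P.normalized a z⟫_ℝ ^ 2 ≤ 2 / d * ‖V‖ ^ 2 := by
  calc ∑ z, P.prob (nullState a) z * ⟪V, P.normalized a z⟫_ℝ ^ 2
      ≤ ∑ z, P.prob (nullState a) z * (2 * ⟪Vᵀ * V, P.normalized a z⟫_ℝ) :=
        Finset.sum_le_sum fun z _ => mul_le_mul_of_nonneg_left (P.inner_normalized_sq_le ha V z)
          (P.prob_nullState_nonneg ha z)
    _ = 2 / d * ‖V‖ ^ 2 := by
        simp only [mul_left_comm _ (2 : ℝ), ← Finset.mul_sum, P.mean_inner_normalized ha,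
          trace_transpose_mul_self_eq]
        ring

lemma isBoundedIncrement_center_normalized (hd : 0 < d) (ha : IsReference a) :
    IsBoundedIncrement (P.prob (nullState a)) (fun z => center (P.normalized a z)) (2 / d) 2 where
  nonneg z := P.prob_nullState_nonneg ha z
  sum_eq_one := P.sum_prob_nullState hd ha
  mean_eq_zero := by
    have hone : center (1 : Matrix (Fin d) (Fin d) ℝ) = 0 := by
      simp [center_apply, hd.ne']
    simp only [← map_smul]
    rw [← map_sum, P.mean_normalized ha, map_smul, hone, smul_zero]
  norm_le z := norm_center_le_two (P.normalized_posSemidef ha z) (P.trace_normalized_le ha z)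
  covariance_le V := by
    simp only [← inner_center_left]
    refine (P.covariance_normalized_le ha (center V)).trans ?_
    gcongr
    exact norm_center_le V

end POVM

namespace LearningTree

variable (T : LearningTree d n Z)

/-- The normalized POVM element of the outcome at step `t` of the path to the leaf `x`. -/
noncomputable def pathElem (a : Fin d → ℝ) (x : Fin n → Z) (t : Fin n) :
    Matrix (Fin d) (Fin d) ℝ := (T.povm t (pathHistory x t)).normalized a (x t)

lemma pathElem_posSemidef (ha : IsReference a) (x : Fin n → Z) (t : Fin n) :
    (T.pathElem a x t).PosSemidef := (T.povm t _).normalized_posSemidef ha _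

lemma trace_pathElem_le (ha : IsReference a) (x : Fin n → Z) (t : Fin n) :
    (T.pathElem a x t).trace ≤ 2 := (T.povm t _).trace_normalized_le ha _

lemma isTreeMartingale (hd : 0 < d) (ha : IsReference a) :
    IsTreeMartingale (fun t h => (T.povm t h).prob (nullState a))
      (fun t h z => center ((T.povm t h).normalized a z)) (2 / d) 2 :=
  fun t h => (T.povm t h).isBoundedIncrement_center_normalized hd ha

lemma nullDist_nonneg (ha : IsReference a) (x : Fin n → Z) : 0 ≤ T.nullDist a x := by
  rw [nullDist, leafProb]
  exact Finset.prod_nonneg fun t _ => (T.povm t _).prob_nullState_nonneg ha _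

lemma sum_nullDist (hd : 0 < d) (ha : IsReference a) : ∑ x, T.nullDist a x = 1 :=
  (T.isTreeMartingale hd ha).sum_pathWeight

lemma mean_norm_centeredSum_sq_le (hd : 0 < d) (ha : IsReference a) :
    ∑ x, T.nullDist a x * ‖centeredSum (T.pathElem a x)‖ ^ 2 ≤ 4 * n :=
  (T.isTreeMartingale hd ha).mean_norm_sum_sq_le.trans_eq (by ring)

lemma mean_sq_norm_centeredSum_sq_sub_le (hd : 0 < d) (ha : IsReference a) :
    ∑ x, T.nullDist a x * (‖centeredSum (T.pathElem a x)‖ ^ 2 -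
      ∑ t, ‖center (T.pathElem a x t)‖ ^ 2) ^ 2 ≤ 16 * n ^ 2 / d :=
  ((T.isTreeMartingale hd ha).mean_sq_norm_sum_sq_sub_le (by positivity)).trans_eq (by ring)

lemma mean_sum_inner_centeredSum_sq_le (hd : 0 < d) (ha : IsReference a) :
    ∑ x, T.nullDist a x * ∑ t, ⟪centeredSum (T.pathElem a x), center (T.pathElem a x t)⟫_ℝ ^ 2 ≤
      12 * n ^ 2 / d + 32 * n :=
  ((T.isTreeMartingale hd ha).mean_sum_inner_sq_le (by positivity)).trans_eq (by ring)

lemma leafProb_perturbedState (ha : IsReference a) (ε : ℝ) (M : Matrix (Fin d) (Fin d) ℝ)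
    (x : Fin n → Z) :
    T.leafProb (perturbedState a ε M) x =
      T.nullDist a x * ∏ t, (1 + ε * ⟪M, T.pathElem a x t⟫_ℝ) := by
  rw [nullDist, leafProb, leafProb, ← Finset.prod_mul_distrib]
  exact Finset.prod_congr rfl fun t _ => (T.povm t _).prob_perturbedState ha ε M (x t)

lemma sum_leafProb_perturbedState (hd : 0 < d) (ha : IsReference a) (ε : ℝ)
    {M : Matrix (Fin d) (Fin d) ℝ} (hM : M.trace = 0) :
    ∑ x, T.leafProb (perturbedState a ε M) x = 1 :=
  sum_pathWeight_eq_one (fun t h => (T.povm t h).prob (perturbedState a ε M))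
    fun t h => (T.povm t h).sum_prob_perturbedState hd ha ε hM

end LearningTree

end Povm

section AltDist

open Matrix
open scoped InnerProductSpace Matrix.Norms.Frobenius

variable {d n : ℕ} {Z : Type} [Fintype Z] {a : Fin d → ℝ}

instance instBorelSpaceRealMatrix (d : ℕ) : BorelSpace (Matrix (Fin d) (Fin d) ℝ) :=
  inferInstanceAs (BorelSpace (Fin d → Fin d → ℝ))

lemma measurableSet_truncationSet (d : ℕ) : MeasurableSet (truncationSet d) := by
  have hop : Continuous fun M : Matrix (Fin d) (Fin d) ℝ =>
      toEuclideanCLM (n := Fin d) (𝕜 := ℝ) M :=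
    (toEuclideanCLM (n := Fin d) (𝕜 := ℝ)).toAlgEquiv.toLinearMap.continuous_of_finiteDimensional
  have hfrob : Continuous fun M : Matrix (Fin d) (Fin d) ℝ => ∑ i, ∑ j, M i j ^ 2 :=
    continuous_finsetSum _ fun i _ => continuous_finsetSum _ fun j _ =>
      (continuous_id.matrix_elem i j).pow 2
  rw [truncationSet, Set.ofPred_and]
  exact ((isClosed_le hop.norm continuous_const).inter
    (isClosed_le continuous_const hfrob)).measurableSet

lemma measurable_goeMat :
    Measurable (goeMat : (Sym2 (Fin d) → ℝ) → Matrix (Fin d) (Fin d) ℝ) :=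
  goeMat.continuous_of_finiteDimensional.measurable

lemma goeStar_eq_map (d : ℕ) : goeStar d = (goeEntries d).map goeMat := by
  have hsymMat : Measurable (symMat : (Sym2 (Fin d) → ℝ) → Matrix (Fin d) (Fin d) ℝ) :=
    symMat.continuous_of_finiteDimensional.measurable
  have hcenter : (fun G : Matrix (Fin d) (Fin d) ℝ => G - (G.trace / (d : ℝ)) • 1) = center :=
    funext fun G => by rw [center_apply, Fintype.card_fin]
  rw [goeStar, hcenter]
  exact Measure.map_map center.continuous_of_finiteDimensional.measurable hsymMat

lemma integral_truncatedGoeStar {f : Matrix (Fin d) (Fin d) ℝ → ℝ} (hf : Measurable f) :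
    ∫ M, f M ∂truncatedGoeStar d =
      ((goeEntries d).real (truncatedEntries d))⁻¹ *
        ∫ g in truncatedEntries d, f (goeMat g) ∂goeEntries d := by
  have hpreimage : goeMat ⁻¹' truncationSet d = truncatedEntries d :=
    Set.ext goeMat_mem_truncationSet_iff
  rw [truncatedGoeStar, ProbabilityTheory.cond, integral_smul_measure, goeStar_eq_map,
    Measure.map_apply measurable_goeMat (measurableSet_truncationSet d),
    Measure.restrict_map measurable_goeMat (measurableSet_truncationSet d), hpreimage,
    integral_map measurable_goeMat.aemeasurable hf.aestronglyMeasurable, ENNReal.toReal_inv,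
    smul_eq_mul, measureReal_def]

namespace LearningTree

variable (T : LearningTree d n Z)

/-- The likelihood ratio of the leaf `x`, when the random state is given by the matrix entries
`g`. -/
noncomputable def likelihood (a : Fin d → ℝ) (ε : ℝ) (x : Fin n → Z) (g : Sym2 (Fin d) → ℝ) : ℝ :=
  ∏ t, (1 + ε * ⟪goeMat g, T.pathElem a x t⟫_ℝ)

lemma abs_mul_inner_pathElem_le (ha : IsReference a) {ε : ℝ} (hε : 0 ≤ ε) (hε' : ε ≤ 1 / 12)
    (x : Fin n → Z) {g : Sym2 (Fin d) → ℝ} (hg : g ∈ truncatedEntries d) (t : Fin n) :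
    |ε * ⟪goeMat g, T.pathElem a x t⟫_ℝ| ≤ 1 / 2 := by
  have hinner : |⟪goeMat g, T.pathElem a x t⟫_ℝ| ≤ 3 * (T.pathElem a x t).trace :=
    abs_inner_le_mul_trace (T.pathElem_posSemidef ha x t) hg.1
  rw [abs_mul, abs_of_nonneg hε]
  calc ε * |⟪goeMat g, T.pathElem a x t⟫_ℝ| ≤ 1 / 12 * (3 * 2) := by
        gcongr
        exact hinner.trans (by gcongr; exact T.trace_pathElem_le ha x t)
    _ = 1 / 2 := by norm_num

lemma likelihood_nonneg (ha : IsReference a) {ε : ℝ} (hε : 0 ≤ ε) (hε' : ε ≤ 1 / 12)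
    (x : Fin n → Z) {g : Sym2 (Fin d) → ℝ} (hg : g ∈ truncatedEntries d) :
    0 ≤ T.likelihood a ε x g :=
  Finset.prod_nonneg fun t _ => by
    linarith [(abs_le.1 (T.abs_mul_inner_pathElem_le ha hε hε' x hg t)).1]

lemma ae_likelihood_nonneg (ha : IsReference a) {ε : ℝ} (hε : 0 ≤ ε) (hε' : ε ≤ 1 / 12)
    (x : Fin n → Z) :
    0 ≤ᵐ[(goeEntries d).restrict (truncatedEntries d)] T.likelihood a ε x :=
  ae_restrict_of_forall_mem (measurableSet_goeRegion _ _)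
    fun _ hg => T.likelihood_nonneg ha hε hε' x hg

lemma integrableOn_likelihood (ha : IsReference a) {ε : ℝ} (hε : 0 ≤ ε) (hε' : ε ≤ 1 / 12)
    (x : Fin n → Z) : IntegrableOn (T.likelihood a ε x) (truncatedEntries d) (goeEntries d) := by
  have hmeas : Measurable (T.likelihood a ε x) :=
    (continuous_prod_one_add_inner ε (T.pathElem a x)).measurable.comp measurable_goeMat
  refine Integrable.of_bound hmeas.aestronglyMeasurable ((3 / 2) ^ n) <|
    ae_restrict_of_forall_mem (measurableSet_goeRegion _ _) fun g hg => ?_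
  rw [likelihood, norm_prod]
  refine (Finset.prod_le_prod (fun _ _ => norm_nonneg _) (g := fun _ => 3 / 2)
    fun t _ => ?_).trans_eq (Fin.prod_const n _)
  calc ‖1 + ε * ⟪goeMat g, T.pathElem a x t⟫_ℝ‖ ≤ ‖(1 : ℝ)‖ + 1 / 2 :=
        (norm_add_le _ _).trans
          (by gcongr; exact T.abs_mul_inner_pathElem_le ha hε hε' x hg t)
    _ = 3 / 2 := by norm_num

/-- The likelihood ratio of the leaf `x` between the two hypotheses: the mean of the likelihood
ratio given the random state. -/
noncomputable def meanLikelihood (a : Fin d → ℝ) (ε : ℝ) (x : Fin n → Z) : ℝ :=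
  ((goeEntries d).real (truncatedEntries d))⁻¹ *
    ∫ g in truncatedEntries d, T.likelihood a ε x g ∂goeEntries d

lemma altDist_eq (ha : IsReference a) (ε : ℝ) (x : Fin n → Z) :
    T.altDist a ε x = T.nullDist a x * T.meanLikelihood a ε x := by
  simp only [altDist, T.leafProb_perturbedState ha]
  rw [integral_const_mul, integral_truncatedGoeStar
    (continuous_prod_one_add_inner ε (T.pathElem a x)).measurable]
  rfl

lemma sum_nullDist_mul_likelihood (hd : 0 < d) (ha : IsReference a) (ε : ℝ)
    (g : Sym2 (Fin d) → ℝ) : ∑ x, T.nullDist a x * T.likelihood a ε x g = 1 := by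
  simp only [likelihood, ← T.leafProb_perturbedState ha]
  exact T.sum_leafProb_perturbedState hd ha ε (trace_goeMat g)

lemma sum_altDist (hd : 0 < d) (ha : IsReference a) {ε : ℝ} (hε : 0 ≤ ε) (hε' : ε ≤ 1 / 12)
    (hU : (goeEntries d).real (truncatedEntries d) ≠ 0) : ∑ x, T.altDist a ε x = 1 := by
  simp only [T.altDist_eq ha, meanLikelihood, mul_left_comm (T.nullDist a _),
    ← integral_const_mul (T.nullDist a _)]
  rw [← Finset.mul_sum, ← integral_finsetSum _ fun x _ =>
    (T.integrableOn_likelihood ha hε hε' x).const_mul _]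
  simp only [T.sum_nullDist_mul_likelihood hd ha, setIntegral_const, smul_eq_mul, mul_one]
  exact inv_mul_cancel₀ hU

lemma meanLikelihood_nonneg (ha : IsReference a) {ε : ℝ} (hε : 0 ≤ ε) (hε' : ε ≤ 1 / 12)
    (x : Fin n → Z) : 0 ≤ T.meanLikelihood a ε x :=
  mul_nonneg (inv_nonneg.2 measureReal_nonneg)
    (integral_nonneg_of_ae (T.ae_likelihood_nonneg ha hε hε' x))

lemma setIntegral_likelihood_le_meanLikelihood (ha : IsReference a) {ε : ℝ} (hε : 0 ≤ ε)
    (hε' : ε ≤ 1 / 12) (hU : (goeEntries d).real (truncatedEntries d) ≠ 0) (x : Fin n → Z) :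
    ∫ g in truncatedEntries d, T.likelihood a ε x g ∂goeEntries d ≤ T.meanLikelihood a ε x :=
  le_mul_of_one_le_left (integral_nonneg_of_ae (T.ae_likelihood_nonneg ha hε hε' x))
    ((one_le_inv₀ (measureReal_nonneg.lt_of_ne' hU)).2 measureReal_le_one)

lemma le_meanLikelihood (ha : IsReference a) {ε : ℝ} (hε : 0 ≤ ε) (hε' : ε ≤ 1 / 12)
    (hU : (goeEntries d).real (truncatedEntries d) ≠ 0) (x : Fin n → Z) {b : ℝ}
    (h : ENNReal.ofReal b ≤
      ∫⁻ g in truncatedEntries d, ENNReal.ofReal (T.likelihood a ε x g) ∂goeEntries d) :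
    b ≤ T.meanLikelihood a ε x := by
  have hnonneg := T.ae_likelihood_nonneg ha hε hε' x
  rw [← ofReal_integral_eq_lintegral_ofReal (T.integrableOn_likelihood ha hε hε' x) hnonneg,
    ENNReal.ofReal_le_ofReal_iff (integral_nonneg_of_ae hnonneg)] at h
  exact h.trans (T.setIntegral_likelihood_le_meanLikelihood ha hε hε' hU x)

end LearningTree

end AltDist

section TotalVariation

lemma tvDist_mul_le {S : Type} [Fintype S] (p L b : S → ℝ) (hp : ∀ x, 0 ≤ p x)
    (hp_sum : ∑ x, p x = 1) (hL_sum : ∑ x, p x * L x = 1) (hb_nonneg : ∀ x, 0 ≤ b x)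
    (hb : ∀ x, 1 - L x ≤ b x) : tvDist p (fun x => p x * L x) ≤ ∑ x, p x * b x := by
  have hle (x : S) : |p x - p x * L x| ≤ 2 * (p x * b x) - (p x - p x * L x) := by
    have hdeficit := mul_le_mul_of_nonneg_left (hb x) (hp x)
    have hbound := mul_nonneg (hp x) (hb_nonneg x)
    rw [abs_le]
    constructor <;> linarith
  have hsum := Finset.sum_le_sum fun x (_ : x ∈ Finset.univ) => hle x
  rw [Finset.sum_sub_distrib, Finset.sum_sub_distrib, ← Finset.mul_sum, hp_sum, hL_sum] at hsum
  rw [tvDist]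
  linarith

lemma sum_mul_abs_le_of_sum_mul_sq_le {S : Type*} [Fintype S] {p f : S → ℝ} {b : ℝ}
    (hp : ∀ x, 0 ≤ p x) (hp_sum : ∑ x, p x = 1) (hb : 0 ≤ b)
    (hf : ∑ x, p x * f x ^ 2 ≤ b ^ 2) : ∑ x, p x * |f x| ≤ b := by
  have hjensen := Real.pow_arith_mean_le_arith_mean_pow Finset.univ p (fun x => |f x|)
    (fun x _ => hp x) hp_sum (fun x _ => abs_nonneg (f x)) 2
  simp only [sq_abs] at hjensen
  exact (abs_le_of_sq_le_sq' (hjensen.trans hf) hb).2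

lemma one_sub_mul_exp_le {v α s q w k : ℝ} (hv0 : 0 < v) (hv1 : v ≤ 1) (hα : 0 ≤ α)
    (hw : 0 ≤ w) :
    1 - v * Real.exp (α * (s - v⁻¹ * q) - w - k * v⁻¹) ≤
      (1 - v) + α * (1 - v) * q + k + α * |s - q| + w := by
  have hexp := mul_le_mul_of_nonneg_left
    (Real.add_one_le_exp (α * (s - v⁻¹ * q) - w - k * v⁻¹)) hv0.le
  have hsplit : v * (α * (s - v⁻¹ * q) - w - k * v⁻¹ + 1) =
      α * (v * (s - q)) - α * (1 - v) * q - v * w - k + v := by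
    field_simp
    ring
  have habs : -|s - q| ≤ v * (s - q) := by
    nlinarith [neg_abs_le (s - q), abs_nonneg (s - q)]
  linarith [mul_le_mul_of_nonneg_left habs hα, mul_le_of_le_one_left hw hv1]

lemma error_budget_le {d n ε K u : ℝ} (hd : 1 ≤ d) (hε : 0 < ε) (hε' : ε ≤ 1 / 12) (hn : 0 ≤ n)
    (hn' : n * ε ^ 2 / (d * √d) ≤ 1) (hK : 0 ≤ K) (hu : u ≤ K / d) :
    u + ε ^ 2 / d * u * (4 * n) + 800 * (n * ε ^ 3 / (d * √d)) + ε ^ 2 / d * (4 * n / √d) +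
        ε ^ 2 * (2 * ε / d) ^ 2 * (12 * n ^ 2 / d + 32 * n) + 100 * (2 * ε / d) ^ 2 * (4 * n) ≤
      K / d + (4 * K + 1800) * (n * ε ^ 2 / (d * √d)) := by
  have hsqrt : √d ^ 2 = d := Real.sq_sqrt (by linarith)
  have hr : 1 ≤ √d := Real.one_le_sqrt.2 hd
  generalize √d = r at *
  subst hsqrt
  set k := n * ε ^ 2 / (r ^ 2 * r) with hk
  have hk0 : 0 ≤ k := by positivity
  have hnk : n = k * (r ^ 3 / ε ^ 2) := by
    rw [hk]
    field_simp
  have hkr : k / r ≤ k := div_le_self hk0 hr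
  have hatypical : ε ^ 2 / r ^ 2 * u * (4 * n) ≤ 4 * K * k := by
    calc ε ^ 2 / r ^ 2 * u * (4 * n) ≤ ε ^ 2 / r ^ 2 * (K / r ^ 2) * (4 * n) := by gcongr
      _ = 4 * K * (k / r) := by rw [hnk]; field_simp
      _ ≤ 4 * K * k := by gcongr
  have hpenalty : 800 * (n * ε ^ 3 / (r ^ 2 * r)) ≤ 70 * k := by
    calc 800 * (n * ε ^ 3 / (r ^ 2 * r)) = 800 * (k * ε) := by rw [hk]; ring
      _ ≤ 800 * (k * (1 / 12)) := by gcongr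
      _ ≤ 70 * k := by linarith
  have hcross : ε ^ 2 / r ^ 2 * (4 * n / r) = 4 * k := by rw [hk]; ring
  have hquad : ε ^ 2 * (2 * ε / r ^ 2) ^ 2 * (12 * n ^ 2 / r ^ 2 + 32 * n) ≤ 49 * k := by
    calc ε ^ 2 * (2 * ε / r ^ 2) ^ 2 * (12 * n ^ 2 / r ^ 2 + 32 * n)
        = 48 * (k * k) + 128 * ε ^ 2 * (k / r) := by rw [hnk]; field_simp; ring
      _ ≤ 48 * (k * 1) + 128 * (1 / 12) ^ 2 * k := by gcongr
      _ ≤ 49 * k := by linarith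
  have hnorm : 100 * (2 * ε / r ^ 2) ^ 2 * (4 * n) = 1600 * (k / r) := by
    rw [hnk]
    field_simp
    ring
  linarith

open scoped InnerProductSpace Matrix.Norms.Frobenius

variable {d n : ℕ} {Z : Type} [Fintype Z] {a : Fin d → ℝ}

namespace LearningTree

variable (T : LearningTree d n Z)

/-- An upper bound for the amount by which the likelihood ratio of the leaf `x` falls short of `1`,
when typical matrices have probability `v`. Its last term makes the bound trivial for the leaves at
which the shift of the GOE would be too large. -/
noncomputable def deficitBound (a : Fin d → ℝ) (ε v : ℝ) (x : Fin n → Z) : ℝ :=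
  (1 - v) + ε ^ 2 / d * (1 - v) * (4 * n) + 800 * (n * ε ^ 3 / (d * √d)) +
    ε ^ 2 / d * |‖centeredSum (T.pathElem a x)‖ ^ 2 - ∑ t, ‖center (T.pathElem a x t)‖ ^ 2| +
    ε ^ 2 * (2 * ε / d) ^ 2 *
      ∑ t, ⟪centeredSum (T.pathElem a x), center (T.pathElem a x t)⟫_ℝ ^ 2 +
    100 * (2 * ε / d) ^ 2 * ‖centeredSum (T.pathElem a x)‖ ^ 2

lemma sum_norm_center_pathElem_sq_le (ha : IsReference a) (x : Fin n → Z) :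
    ∑ t, ‖center (T.pathElem a x t)‖ ^ 2 ≤ 4 * n := by
  calc ∑ t, ‖center (T.pathElem a x t)‖ ^ 2 ≤ ∑ _t : Fin n, (2 : ℝ) ^ 2 := by
        gcongr with t
        exact norm_center_le_two (T.pathElem_posSemidef ha x t) (T.trace_pathElem_le ha x t)
    _ = 4 * n := by
        rw [Finset.sum_const, Finset.card_univ, Fintype.card_fin, nsmul_eq_mul]
        ring

lemma deficitBound_nonneg {ε v : ℝ} (hε : 0 ≤ ε) (hv : v ≤ 1) (x : Fin n → Z) :
    0 ≤ T.deficitBound a ε v x := by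
  have := sub_nonneg.2 hv
  rw [deficitBound]
  positivity

lemma one_sub_meanLikelihood_le_of_norm_le (hd : 0 < d) (ha : IsReference a) {ε : ℝ}
    (hε : 0 ≤ ε) (hε' : ε ≤ 1 / 12) {v : ℝ} (hv : v = (goeEntries d).real (typicalSet d))
    (hv0 : 0 < v) {x : Fin n → Z}
    (hS : (2 * ε / d) ^ 2 * ‖centeredSum (T.pathElem a x)‖ ^ 2 ≤ 1 / 100) :
    1 - T.meanLikelihood a ε x ≤ T.deficitBound a ε v x := by
  have hv1 : v ≤ 1 := hv ▸ measureReal_le_one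
  have hU : (goeEntries d).real (truncatedEntries d) ≠ 0 :=
    (hv0.trans_le (hv ▸ measureReal_mono (typicalSet_subset_truncatedEntries d))).ne'
  have hlikelihood := T.le_meanLikelihood ha hε hε' hU x
    (le_lintegral_likelihood hd hε hε' (T.pathElem_posSemidef ha x) (T.trace_pathElem_le ha x)
      hS hv hv0)
  have hexp := one_sub_mul_exp_le hv0 hv1 (by positivity : 0 ≤ ε ^ 2 / d)
    (s := ‖centeredSum (T.pathElem a x)‖ ^ 2) (q := ∑ t, ‖center (T.pathElem a x t)‖ ^ 2)
    (k := 800 * (n * ε ^ 3 / (d * √d))) (by positivity :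
      0 ≤ ε ^ 2 * (2 * ε / d) ^ 2 *
        ∑ t, ⟪centeredSum (T.pathElem a x), center (T.pathElem a x t)⟫_ℝ ^ 2)
  have hcenter := mul_le_mul_of_nonneg_left (T.sum_norm_center_pathElem_sq_le ha x)
    (mul_nonneg (by positivity) (by linarith) : 0 ≤ ε ^ 2 / d * (1 - v))
  have hnorm : 0 ≤ 100 * (2 * ε / d) ^ 2 * ‖centeredSum (T.pathElem a x)‖ ^ 2 := by positivity
  rw [deficitBound]
  linarith

lemma one_sub_meanLikelihood_le (hd : 0 < d) (ha : IsReference a) {ε : ℝ} (hε : 0 ≤ ε)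
    (hε' : ε ≤ 1 / 12) {v : ℝ} (hv : v = (goeEntries d).real (typicalSet d)) (hv0 : 0 < v)
    (x : Fin n → Z) : 1 - T.meanLikelihood a ε x ≤ T.deficitBound a ε v x := by
  by_cases hS : (2 * ε / d) ^ 2 * ‖centeredSum (T.pathElem a x)‖ ^ 2 ≤ 1 / 100
  · exact T.one_sub_meanLikelihood_le_of_norm_le hd ha hε hε' hv hv0 hS
  · have hv1 : 0 ≤ 1 - v := sub_nonneg.2 (hv ▸ measureReal_le_one)
    calc 1 - T.meanLikelihood a ε x ≤ 1 := sub_le_self _ (T.meanLikelihood_nonneg ha hε hε' x)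
      _ ≤ 100 * (2 * ε / d) ^ 2 * ‖centeredSum (T.pathElem a x)‖ ^ 2 := by linarith
      _ ≤ T.deficitBound a ε v x := le_add_of_nonneg_left (by positivity)

lemma mean_abs_norm_centeredSum_sq_sub_le (hd : 0 < d) (ha : IsReference a) :
    ∑ x, T.nullDist a x * |‖centeredSum (T.pathElem a x)‖ ^ 2 -
      ∑ t, ‖center (T.pathElem a x t)‖ ^ 2| ≤ 4 * n / √d := by
  refine sum_mul_abs_le_of_sum_mul_sq_le (T.nullDist_nonneg ha) (T.sum_nullDist hd ha)
    (by positivity) ((T.mean_sq_norm_centeredSum_sq_sub_le hd ha).trans_eq ?_)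
  rw [div_pow, Real.sq_sqrt (Nat.cast_nonneg d)]
  ring

lemma mean_deficitBound_le (hd : 0 < d) (ha : IsReference a) (ε v : ℝ) :
    ∑ x, T.nullDist a x * T.deficitBound a ε v x ≤
      (1 - v) + ε ^ 2 / d * (1 - v) * (4 * n) + 800 * (n * ε ^ 3 / (d * √d)) +
        ε ^ 2 / d * (4 * n / √d) + ε ^ 2 * (2 * ε / d) ^ 2 * (12 * n ^ 2 / d + 32 * n) +
        100 * (2 * ε / d) ^ 2 * (4 * n) := by
  simp only [deficitBound, mul_add (T.nullDist a _), Finset.sum_add_distrib, ← Finset.sum_mul,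
    T.sum_nullDist hd ha, one_mul, mul_left_comm (T.nullDist a _), ← Finset.mul_sum]
  gcongr
  · exact T.mean_abs_norm_centeredSum_sq_sub_le hd ha
  · exact T.mean_sum_inner_centeredSum_sq_le hd ha
  · exact T.mean_norm_centeredSum_sq_le hd ha

end LearningTree

lemma four_le_of_typicalConst_lt (hd : typicalConst < d) : 4 ≤ d := by
  have hconst : 4 ≤ typicalConst := by
    rw [typicalConst]
    linarith [Real.exp_pos 2]
  exact_mod_cast hconst.trans hd.le

lemma one_sub_measure_typicalSet_le (hd : typicalConst < d) :
    1 - (goeEntries d).real (typicalSet d) ≤ typicalConst / d := by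
  rw [← probReal_compl_eq_one_sub (measurableSet_goeRegion _ _)]
  exact measure_typicalSet_compl_le (four_le_of_typicalConst_lt hd)

lemma measure_typicalSet_pos (hd : typicalConst < d) : 0 < (goeEntries d).real (typicalSet d) := by
  have hlt : typicalConst / d < 1 := (div_lt_one (typicalConst_pos.trans hd)).2 hd
  linarith [one_sub_measure_typicalSet_le hd]

namespace LearningTree

variable (T : LearningTree d n Z)

lemma sum_altDist_of_typicalConst_lt (hd : typicalConst < d) (ha : IsReference a) {ε : ℝ}
    (hε : 0 ≤ ε) (hε' : ε ≤ 1 / 12) : ∑ x, T.altDist a ε x = 1 :=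
  T.sum_altDist (by linarith [four_le_of_typicalConst_lt hd]) ha hε hε' <| ne_of_gt <|
    (measure_typicalSet_pos hd).trans_le (measureReal_mono (typicalSet_subset_truncatedEntries d))

lemma tvDist_le (hd : typicalConst < d) (ha : IsReference a) {ε : ℝ} (hε : 0 < ε)
    (hε' : ε ≤ 1 / 12) (hn : n * ε ^ 2 / (d * √d) ≤ 1) :
    tvDist (T.nullDist a) (T.altDist a ε) ≤
      typicalConst / d + (4 * typicalConst + 1800) * (n * ε ^ 2 / (d * √d)) := by
  have hd0 : 0 < d := by linarith [four_le_of_typicalConst_lt hd]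
  have halt : T.altDist a ε = fun x => T.nullDist a x * T.meanLikelihood a ε x :=
    funext (T.altDist_eq ha ε)
  have hsum := T.sum_altDist_of_typicalConst_lt hd ha hε.le hε'
  rw [halt] at hsum ⊢
  refine (tvDist_mul_le _ _ _ (T.nullDist_nonneg ha) (T.sum_nullDist hd0 ha) hsum
    (T.deficitBound_nonneg hε.le measureReal_le_one)
    (T.one_sub_meanLikelihood_le hd0 ha hε.le hε' rfl (measure_typicalSet_pos hd))).trans ?_
  exact (T.mean_deficitBound_le hd0 ha ε _).trans <|
    error_budget_le (by exact_mod_cast hd0) hε hε' (Nat.cast_nonneg n) hn typicalConst_pos.le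
      (one_sub_measure_typicalSet_le hd)

end LearningTree

lemma LearningTree.Distinguishes.third_le_tvDist {T : LearningTree d n Z} {ε : ℝ}
    {φ : (Fin n → Z) → ℝ} (h : T.Distinguishes a ε φ) (hnull : ∑ x, T.nullDist a x = 1)
    (halt : ∑ x, T.altDist a ε x = 1) : 1 / 3 ≤ tvDist (T.nullDist a) (T.altDist a ε) := by
  obtain ⟨hφ, hnull_success, halt_success⟩ := h
  have hle (x : Fin n → Z) : T.altDist a ε x * φ x + T.nullDist a x * (1 - φ x) ≤
      1 / 2 * |T.nullDist a x - T.altDist a ε x| +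
        1 / 2 * (T.nullDist a x + T.altDist a ε x) := by
    obtain ⟨hφ0, hφ1⟩ := hφ x
    rcases abs_cases (T.nullDist a x - T.altDist a ε x) with ⟨habs, _⟩ | ⟨habs, _⟩ <;>
      rw [habs] <;> nlinarith
  have hsum := Finset.sum_le_sum fun x (_ : x ∈ Finset.univ) => hle x
  rw [Finset.sum_add_distrib, Finset.sum_add_distrib, ← Finset.mul_sum, ← Finset.mul_sum,
    Finset.sum_add_distrib, hnull, halt] at hsum
  rw [tvDist]
  linarith

lemma div_mul_sqrt_le_of_le {d n ε c : ℝ} (hd : 0 < d) (hε : 0 < ε)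
    (hn : n ≤ c * (d ^ (3 / 2 : ℝ) / ε ^ 2)) : n * ε ^ 2 / (d * √d) ≤ c := by
  have hpow : d ^ (3 / 2 : ℝ) = d * √d := by
    rw [Real.sqrt_eq_rpow, ← Real.rpow_one_add' hd.le (by norm_num)]
    norm_num
  have hsqrt : 0 < √d := Real.sqrt_pos.2 hd
  rw [hpow, ← mul_div_assoc, le_div_iff₀ (by positivity)] at hn
  rwa [div_le_iff₀ (by positivity)]

lemma exists_tvDist_le (δ : ℝ) (hδ : 0 < δ) : ∃ c : ℝ, 0 < c ∧ ∃ d₀ : ℕ, ∀ d : ℕ, d₀ ≤ d →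
    ∀ ε : ℝ, 0 < ε → ε ≤ 1 / 12 → ∀ a : Fin d → ℝ, IsReference a →
    ∀ (Z : Type) [Fintype Z] (n : ℕ) (T : LearningTree d n Z),
      (n : ℝ) ≤ c * ((d : ℝ) ^ (3 / 2 : ℝ) / ε ^ 2) →
      ∑ x, T.nullDist a x = 1 ∧ ∑ x, T.altDist a ε x = 1 ∧
        tvDist (T.nullDist a) (T.altDist a ε) ≤ δ := by
  have hC := typicalConst_pos
  set C := typicalConst with hC_def
  refine ⟨min 1 (δ / (2 * (4 * C + 1800))), by positivity, max (⌊C⌋₊ + 1) ⌈2 * C / δ⌉₊,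
    fun d hd ε hε hε' a ha Z _ n T hn => ?_⟩
  obtain ⟨hd_floor, hd_ceil⟩ := max_le_iff.1 hd
  have hd_lt : C < d := Nat.lt_of_floor_lt hd_floor
  have hd0 : (0 : ℝ) < d := hC.trans hd_lt
  obtain ⟨hk1, hkδ⟩ := le_min_iff.1 (div_mul_sqrt_le_of_le hd0 hε hn)
  refine ⟨T.sum_nullDist (by exact_mod_cast hd0) ha,
    T.sum_altDist_of_typicalConst_lt hd_lt ha hε.le hε',
    (T.tvDist_le hd_lt ha hε hε' hk1).trans ?_⟩
  rw [← hC_def]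
  have hatypical : C / d ≤ δ / 2 := by
    have hdδ := (div_le_iff₀ hδ).1 (Nat.ceil_le.1 hd_ceil)
    rw [div_le_iff₀ hd0]
    linarith
  have hbudget : (4 * C + 1800) * (n * ε ^ 2 / (d * √d)) ≤ δ / 2 := by
    calc (4 * C + 1800) * (n * ε ^ 2 / (d * √d))
        ≤ (4 * C + 1800) * (δ / (2 * (4 * C + 1800))) := by gcongr
      _ = δ / 2 := by field_simp
  linarith

end TotalVariation

theorem mainTheorem2 :
    (∃ c : ℝ, 0 < c ∧ ∃ d₀ : ℕ, ∀ d : ℕ, d₀ ≤ d →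
      ∀ ε : ℝ, 0 < ε → ε ≤ 1 / 12 →
      ∀ a : Fin d → ℝ, IsReference a →
      ∀ (Z : Type) [Fintype Z] (n : ℕ) (T : LearningTree d n Z)
        (φ : (Fin n → Z) → ℝ),
        T.Distinguishes a ε φ → c * ((d : ℝ) ^ (3 / 2 : ℝ) / ε ^ 2) ≤ (n : ℝ)) ∧
    (∀ δ : ℝ, 0 < δ → ∃ c : ℝ, 0 < c ∧ ∃ d₀ : ℕ, ∀ d : ℕ, d₀ ≤ d →
      ∀ ε : ℝ, 0 < ε → ε ≤ 1 / 12 →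
      ∀ a : Fin d → ℝ, IsReference a →
      ∀ (Z : Type) [Fintype Z] (n : ℕ) (T : LearningTree d n Z),
        (n : ℝ) ≤ c * ((d : ℝ) ^ (3 / 2 : ℝ) / ε ^ 2) →
        tvDist (T.nullDist a) (T.altDist a ε) ≤ δ) := by
  constructor
  · obtain ⟨c, hc, d₀, h⟩ := exists_tvDist_le (1 / 4) (by norm_num)
    refine ⟨c, hc, d₀, fun d hd ε hε hε' a ha Z _ n T φ hφ => ?_⟩
    by_contra! hn
    obtain ⟨h0, h1, h2⟩ := h d hd ε hε hε' a ha Z n T hn.le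
    linarith [hφ.third_le_tvDist h0 h1]
  · intro δ hδ
    obtain ⟨c, hc, d₀, h⟩ := exists_tvDist_le δ hδ
    exact ⟨c, hc, d₀, fun d hd ε hε hε' a ha Z _ n T hn => (h d hd ε hε hε' a ha Z n T hn).2.2⟩
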